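/- Let $n \geq 4$. Let $\Gamma$ be an admissible graph with $n$ half-edges numbered $1,\dots,n$, that is, a finite connected acyclic trivalent graph, where edges with only one endpoint (half-edges) are allowed; edges with two endpoints are called internal. Write $E_{\mathrm{int}}$ for the set of internal edges, and orient each of them. For $a \in E_{\mathrm{int}}$ let $I(a) \subset \{1,\dots,n\}$ be the set of half-edges connected to the initial vertex of $a$ by a path that does not contain the terminal vertex of $a$. Let $\ell_1,\dots,\ell_n$ be positive real numbers with $\ell_j < \tfrac12(\ell_1+\cdots+\ell_n)$ for all $j$. Identify $\mathfrak{su}(2)^*$ with $\mathfrak{su}(2)\simeq\mathbb{R}^3$ by the invariant scalar product $\langle \xi,\eta\rangle=-\tfrac12\operatorname{tr}(\xi\eta)$, let $S^2_r$ be its sphere of radius $r$ centred at the origin, and let $$\mathcal{M}_\ell=\{(x_1,\dots,x_n)\in S^2_{\ell_1}\times\cdots\times S^2_{\ell_n} : x_1+\cdots+x_n=0\}/SU(2)$$ with the quotient topology, where $SU(2)$ acts diagonally by the (co)adjoint action. Let $S_\ell\subset\mathcal{M}_\ell$ be the set of classes $[x_1,\dots,x_n]$ such that all $x_i$ lie on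 one line; $\mathcal{M}_\ell\setminus S_\ell$ is a smooth manifold. Set $$\lambda:\mathcal{M}_\ell\to\mathbb{R}^{E_{\mathrm{int}}},\qquad \lambda_a([x_1,\dots,x_n])=\Bigl|\sum_{i\in I(a)}x_i\Bigr| .$$ Let $\Delta(\ell,\Gamma)\subset\mathbb{R}^{E_{\mathrm{int}}}$ be the set of families $(d_a)$ of non-negative numbers such that, with $d_i:=\ell_i$ for the half-edges $i$, one has $|d_a-d_b|\le d_c\le d_a+d_b$ for any three mutually distinct edges $a,b,c$ incident to the same vertex. Then: 1. The image of $\lambda$ is $\Delta(\ell,\Gamma)$. 2. The fibre $\lambda^{-1}(d)$ is connected for every $d \in \Delta(\ell,\Gamma)$. 3. The set $\mathcal{M}^{\mathrm{reg}}_{\ell,\Gamma}:=\lambda^{-1}(\operatorname{Int}\Delta(\ell,\Gamma))$ is open and dense in $\mathcal{M}_\ell$, and it is contained in the set $\mathcal{M}^*_{\ell,\Gamma}$ of points of $\mathcal{M}_\ell\setminus S_\ell$ at which none of the functions $\lambda_a$ vanishes. 4. For every $x\in\mathcal{M}^{\mathrm{reg}}_{\ell,\Gamma}$ the functions $\lambda_a$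 are smooth at $x$ and their differentials $d_x\lambda_a$, $a\in E_{\mathrm{int}}$, are linearly independent. -/

import Mathlib

open Set Topology
open scoped ContDiff RealInnerProductSpace

noncomputable section

namespace PolygonSpace

/-! ### The Lie algebra `su(2)` and the adjoint action of `SU(2)` -/

/-- Euclidean three-space. -/
abbrev E3 : Type := EuclideanSpace ℝ (Fin 3)

/-- The identification of Euclidean three-space with `su(2)`, the real Lie algebra of traceless
skew-Hermitian `2 × 2` complex matrices. It sends the standard basis to `i σ₁, i σ₂, i σ₃`
(Pauli matrices) and is an isometry for the invariant scalar product `⟨ξ, η⟩ = - (1/2) tr (ξ η)`,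
see `range_toSu2` and `norm_sq_eq_trace`. The dual of `su(2)` is identified with `su(2)` by this
scalar product, so that the coadjoint action becomes the adjoint action. -/
def toSu2 : E3 →ₗ[ℝ] Matrix (Fin 2) (Fin 2) ℂ where
  toFun x := !![Complex.I * (x 2 : ℂ), (x 1 : ℂ) + Complex.I * (x 0 : ℂ);
    -(x 1 : ℂ) + Complex.I * (x 0 : ℂ), -(Complex.I * (x 2 : ℂ))]
  map_add' x y := by
    ext i j
    fin_cases i <;> fin_cases j <;> simp <;> ring
  map_smul' c x := by
    ext i j
    fin_cases i <;> fin_cases j <;> simp <;> ring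

theorem range_toSu2 :
    Set.range toSu2 = {A : Matrix (Fin 2) (Fin 2) ℂ | star A = -A ∧ A.trace = 0} := by
  ext A
  constructor
  · rintro ⟨x, rfl⟩
    refine ⟨?_, ?_⟩
    · ext i j
      fin_cases i <;> fin_cases j <;> simp [toSu2, Matrix.star_apply, add_comm]
    · simp [toSu2, Matrix.trace_fin_two]
  · rintro ⟨h1, h2⟩
    have h00 := congrFun (congrFun h1 0) 0
    have h01 := congrFun (congrFun h1 0) 1
    rw [Matrix.trace_fin_two] at h2
    simp only [Matrix.star_apply, Matrix.neg_apply, Complex.ext_iff, Complex.star_def,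
      Complex.conj_re, Complex.conj_im, Complex.neg_re, Complex.neg_im, Complex.add_re,
      Complex.add_im, Complex.zero_re, Complex.zero_im] at h00 h01 h2
    refine ⟨!₂[(A 0 1).im, (A 0 1).re, (A 0 0).im], ?_⟩
    ext i j
    fin_cases i <;> fin_cases j <;> simp [toSu2, Complex.ext_iff] <;>
      first | linarith | (constructor <;> linarith)

theorem norm_sq_eq_trace (x : E3) :
    ((‖x‖ ^ 2 : ℝ) : ℂ) = -(1 / 2) * (toSu2 x * toSu2 x).trace := by
  rw [EuclideanSpace.norm_sq_eq, Fin.sum_univ_three]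
  simp only [toSu2, LinearMap.coe_mk, AddHom.coe_mk, Matrix.trace_fin_two, Matrix.mul_apply,
    Fin.sum_univ_two, Matrix.of_apply, Matrix.cons_val', Matrix.cons_val_zero,
    Matrix.cons_val_one, Matrix.cons_val_fin_one, Real.norm_eq_abs, sq_abs]
  push_cast
  linear_combination ((x 2 : ℂ) ^ 2 + (x 0 : ℂ) ^ 2) * Complex.I_sq

/-- Two vectors related by the adjoint action of an element of `SU(2)` have the same norm. -/
theorem norm_eq_of_conj (g : Matrix.specialUnitaryGroup (Fin 2) ℂ) (x y : E3)
    (h : toSu2 y = (g : Matrix (Fin 2) (Fin 2) ℂ) * toSu2 x *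
      star (g : Matrix (Fin 2) (Fin 2) ℂ)) : ‖y‖ = ‖x‖ := by
  have hg : star (g : Matrix (Fin 2) (Fin 2) ℂ) * (g : Matrix (Fin 2) (Fin 2) ℂ) = 1 :=
    Matrix.mem_unitaryGroup_iff'.1 (Matrix.mem_specialUnitaryGroup_iff.1 g.2).1
  have h2 : ((‖y‖ ^ 2 : ℝ) : ℂ) = ((‖x‖ ^ 2 : ℝ) : ℂ) := by
    rw [norm_sq_eq_trace, norm_sq_eq_trace, h]
    congr 1
    have : (g : Matrix (Fin 2) (Fin 2) ℂ) * toSu2 x * star (g : Matrix (Fin 2) (Fin 2) ℂ) *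
        ((g : Matrix (Fin 2) (Fin 2) ℂ) * toSu2 x * star (g : Matrix (Fin 2) (Fin 2) ℂ)) =
        (g : Matrix (Fin 2) (Fin 2) ℂ) * (toSu2 x * toSu2 x *
          star (g : Matrix (Fin 2) (Fin 2) ℂ)) := by
      calc _ = (g : Matrix (Fin 2) (Fin 2) ℂ) * toSu2 x *
          (star (g : Matrix (Fin 2) (Fin 2) ℂ) * (g : Matrix (Fin 2) (Fin 2) ℂ)) * toSu2 x *
            star (g : Matrix (Fin 2) (Fin 2) ℂ) := by simp only [Matrix.mul_assoc]
        _ = _ := by rw [hg]; simp only [Matrix.mul_assoc, Matrix.one_mul]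
    rw [this, Matrix.trace_mul_comm, Matrix.mul_assoc, hg, Matrix.mul_one]
  have h3 : ‖y‖ ^ 2 = ‖x‖ ^ 2 := by exact_mod_cast h2
  exact (sq_eq_sq₀ (norm_nonneg _) (norm_nonneg _)).1 h3

/-! ### The polygon space -/

/-- The closed polygons with side lengths `ℓ`: tuples `(x₁, …, xₙ)` in the product of the spheres
of radius `ℓᵢ` whose sum vanishes. -/
def closedPolygons {n : ℕ} (ℓ : Fin n → ℝ) : Set (Fin n → E3) :=
  {x | (∀ i, ‖x i‖ = ℓ i) ∧ ∑ i, x i = 0}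

/-- Two tuples are equivalent if they lie in the same orbit of the diagonal adjoint action
of `SU(2)`. -/
def orbitSetoid {n : ℕ} (ℓ : Fin n → ℝ) : Setoid (closedPolygons ℓ) where
  r x y := ∃ g : Matrix.specialUnitaryGroup (Fin 2) ℂ, ∀ i,
    toSu2 (y.1 i) = (g : Matrix (Fin 2) (Fin 2) ℂ) * toSu2 (x.1 i) *
      star (g : Matrix (Fin 2) (Fin 2) ℂ)
  iseqv := by
    refine ⟨fun x => ⟨1, fun i => by simp⟩, ?_, ?_⟩
    · rintro x y ⟨g, hg⟩
      have h : star (g : Matrix (Fin 2) (Fin 2) ℂ) * (g : Matrix (Fin 2) (Fin 2) ℂ) = 1 :=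
        Matrix.mem_unitaryGroup_iff'.1 (Matrix.mem_specialUnitaryGroup_iff.1 g.2).1
      refine ⟨star g, fun i => ?_⟩
      have hs : ((star g : Matrix.specialUnitaryGroup (Fin 2) ℂ) : Matrix (Fin 2) (Fin 2) ℂ) =
        star (g : Matrix (Fin 2) (Fin 2) ℂ) := rfl
      rw [hs, star_star, hg i]
      calc toSu2 (x.1 i) = (star (g : Matrix (Fin 2) (Fin 2) ℂ) *
            (g : Matrix (Fin 2) (Fin 2) ℂ)) * toSu2 (x.1 i) *
            (star (g : Matrix (Fin 2) (Fin 2) ℂ) * (g : Matrix (Fin 2) (Fin 2) ℂ)) := by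
              rw [h, Matrix.one_mul, Matrix.mul_one]
        _ = _ := by simp only [Matrix.mul_assoc]
    · rintro x y z ⟨g, hg⟩ ⟨k, hk⟩
      refine ⟨k * g, fun i => ?_⟩
      rw [hk i, hg i]
      simp only [Submonoid.coe_mul, star_mul, Matrix.mul_assoc]

/-- The polygon space `M_ℓ`, the quotient of the closed polygons by `SU(2)`. -/
def ModuliSpace {n : ℕ} (ℓ : Fin n → ℝ) : Type := Quotient (orbitSetoid ℓ)

/-- The polygon space carries the quotient topology. -/
instance {n : ℕ} (ℓ : Fin n → ℝ) : TopologicalSpace (ModuliSpace ℓ) :=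
  inferInstanceAs (TopologicalSpace (Quotient (orbitSetoid ℓ)))

/-- The class `[x₁, …, xₙ]` of a closed polygon. -/
def ModuliSpace.mk {n : ℕ} {ℓ : Fin n → ℝ} (x : closedPolygons ℓ) : ModuliSpace ℓ :=
  Quotient.mk (orbitSetoid ℓ) x

/-- The singular points of the polygon space: the classes of polygons all of whose sides belong
to the same line. -/
def singularSet {n : ℕ} (ℓ : Fin n → ℝ) : Set (ModuliSpace ℓ) :=
  ModuliSpace.mk '' {x | ∃ u : E3, ∀ i, ∃ c : ℝ, x.1 i = c • u}

/-! ### Tangent spaces and differentials on the polygon space -/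

/-- The tangent space at `x` of the set of closed polygons: the kernel of the differential of
the constraints `(‖x₁‖², …, ‖xₙ‖², x₁ + ⋯ + xₙ)`. These constraints are independent unless
all the `xᵢ` belong to the same line. -/
def polygonTangent {n : ℕ} (x : Fin n → E3) : Submodule ℝ (Fin n → E3) where
  carrier := {v | (∀ i, ⟪x i, v i⟫ = 0) ∧ ∑ i, v i = 0}
  add_mem' := by
    rintro v w ⟨hv, hv'⟩ ⟨hw, hw'⟩
    refine ⟨fun i => ?_, ?_⟩
    · rw [Pi.add_apply, inner_add_right, hv i, hw i, add_zero]
    · simp only [Pi.add_apply, Finset.sum_add_distrib, hv', hw', add_zero]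
  zero_mem' := ⟨fun i => by simp, by simp⟩
  smul_mem' := by
    rintro c v ⟨hv, hv'⟩
    refine ⟨fun i => ?_, ?_⟩
    · rw [Pi.smul_apply, inner_smul_right, hv i, mul_zero]
    · simp only [Pi.smul_apply, ← Finset.smul_sum, hv', smul_zero]

/-- The tangent space at `x` of the `SU(2)`-orbit of `x`: the vectors `([ξ, x₁], …, [ξ, xₙ])`
with `ξ` in `su(2)`. -/
def orbitTangent {n : ℕ} (x : Fin n → E3) : Submodule ℝ (Fin n → E3) where
  carrier := {v | ∃ ξ : E3, ∀ i,
    toSu2 (v i) = toSu2 ξ * toSu2 (x i) - toSu2 (x i) * toSu2 ξ}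
  add_mem' := by
    rintro v w ⟨ξ, hξ⟩ ⟨η, hη⟩
    refine ⟨ξ + η, fun i => ?_⟩
    rw [Pi.add_apply, map_add, map_add, hξ i, hη i]
    noncomm_ring
  zero_mem' := ⟨0, fun i => by simp⟩
  smul_mem' := by
    rintro c v ⟨ξ, hξ⟩
    refine ⟨c • ξ, fun i => ?_⟩
    rw [Pi.smul_apply, map_smul, map_smul, hξ i, smul_mul_assoc, mul_smul_comm, smul_sub]

/-- The tangent space of the polygon space at the nonsingular class `[x]`: the quotient of the
tangent space of the closed polygons at `x` by the tangent space of the orbit of `x`. -/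
abbrev QuotientTangent {n : ℕ} (x : Fin n → E3) : Type :=
  ↥(polygonTangent x) ⧸ (orbitTangent x).submoduleOf (polygonTangent x)

/-- The function `f` on the polygon space is smooth at the nonsingular class `[x]`, and `L` is its
differential there. This means that `y ↦ f [y]` is, near `x`, the restriction to the closed
polygons of a smooth function `F` on the ambient space, and that `L` is induced by the differential
of `F` at `x`. Near a nonsingular `x` the closed polygons form a submanifold with tangent space
`polygonTangent x`, so that the value of `L` on a class does not depend on the choice of `F`. -/
def HasDifferentialAt {n : ℕ} {ℓ : Fin n → ℝ} (f : ModuliSpace ℓ → ℝ) (x : closedPolygons ℓ)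
    (L : QuotientTangent x.1 →ₗ[ℝ] ℝ) : Prop :=
  ∃ F : (Fin n → E3) → ℝ, ContDiffAt ℝ ∞ F x.1 ∧
    (∀ᶠ y in 𝓝 x, F y.1 = f (ModuliSpace.mk y)) ∧
    ∀ v : ↥(polygonTangent x.1), L (Submodule.Quotient.mk v) = fderiv ℝ F x.1 v.1

/-! ### Graphs with half-edges -/

/-- A graph with vertex set `V` and `n` numbered half-edges: the internal edges are those of a
simple graph (acyclicity, imposed below, excludes loops and multiple edges anyway), and each
half-edge has exactly one endpoint. -/
structure HalfEdgeGraph (n : ℕ) (V : Type*) where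
  /-- The internal edges. -/
  graph : SimpleGraph V
  /-- The endpoint of each half-edge. -/
  endpoint : Fin n → V

namespace HalfEdgeGraph

variable {n : ℕ} {V : Type*} (Γ : HalfEdgeGraph n V)

/-- The internal edges. -/
abbrev EInt : Type _ := ↥Γ.graph.edgeSet

/-- All edges: internal edges and half-edges. -/
abbrev Edge : Type _ := Γ.EInt ⊕ Fin n

/-- The edge `e` is incident to the vertex `v`. -/
def Incident (v : V) : Γ.Edge → Prop
  | Sum.inl a => v ∈ a.1
  | Sum.inr i => Γ.endpoint i = v

/-- A graph is admissible if it is connected, acyclic and trivalent. -/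
structure Admissible : Prop where
  connected : Γ.graph.Connected
  acyclic : Γ.graph.IsAcyclic
  trivalent : ∀ v, {e | Γ.Incident v e}.ncard = 3

/-- An orientation of the internal edges: each internal edge `a` is given a direction, from the
initial vertex `(o.dart a).fst` to the terminal vertex `(o.dart a).snd`. -/
structure Orientation where
  /-- The directed edge. -/
  dart : Γ.EInt → Γ.graph.Dart
  edge_dart : ∀ a, (dart a).edge = a.1

variable {Γ}

/-- The set `I(a)` of half-edges which are connected to the initial vertex of `a` by a path
which does not contain the terminal vertex of `a`. -/
def Orientation.side (o : Γ.Orientation) (a : Γ.EInt) : Set (Fin n) :=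
  {i | ∃ p : Γ.graph.Walk (Γ.endpoint i) (o.dart a).fst,
    p.IsPath ∧ (o.dart a).snd ∉ p.support}

open Classical in
/-- The map `λ : M_ℓ → ℝ^{E_int}` with components `λ_a [x] = ‖∑_{i ∈ I(a)} xᵢ‖`. -/
def Orientation.lengths (o : Γ.Orientation) (ℓ : Fin n → ℝ) (p : ModuliSpace ℓ) : Γ.EInt → ℝ :=
  Quotient.lift (s := orbitSetoid ℓ)
    (fun (x : closedPolygons ℓ) (a : Γ.EInt) =>
      ‖∑ i ∈ Finset.univ.filter (fun i => i ∈ o.side a), x.1 i‖)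
    (by
      rintro x y ⟨g, hg⟩
      funext a
      refine (norm_eq_of_conj g _ _ ?_).symm
      rw [map_sum, map_sum, Finset.mul_sum, Finset.sum_mul]
      exact Finset.sum_congr rfl fun i _ => hg i) p

variable (Γ)

/-- The polyhedron `Δ(Γ)` of families of nonnegative numbers indexed by all edges such that
at each vertex the triangle inequalities hold. -/
def polyhedron : Set (Γ.Edge → ℝ) :=
  {d | (∀ e, 0 ≤ d e) ∧ ∀ v : V, ∀ a b c : Γ.Edge,
    Γ.Incident v a → Γ.Incident v b → Γ.Incident v c → a ≠ b → b ≠ c → a ≠ c →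
      |d a - d b| ≤ d c ∧ d c ≤ d a + d b}

/-- The polyhedron `Δ(ℓ, Γ)`: the slice of `Δ(Γ)` where the half-edges have the values `ℓ`. -/
def slicedPolyhedron (ℓ : Fin n → ℝ) : Set (Γ.EInt → ℝ) :=
  {d | Sum.elim d ℓ ∈ Γ.polyhedron}

variable {Γ}

/-- The preimage under `λ` of the interior of `Δ(ℓ, Γ)`. -/
def Orientation.regularSet (o : Γ.Orientation) (ℓ : Fin n → ℝ) : Set (ModuliSpace ℓ) :=
  o.lengths ℓ ⁻¹' interior (Γ.slicedPolyhedron ℓ)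

/-- The set of nonsingular points of `M_ℓ` where none of the functions `λ_a` vanishes. -/
def Orientation.nonvanishingSet (o : Γ.Orientation) (ℓ : Fin n → ℝ) : Set (ModuliSpace ℓ) :=
  {p | p ∉ singularSet ℓ ∧ ∀ a, o.lengths ℓ p a ≠ 0}

end HalfEdgeGraph

end PolygonSpace

end

noncomputable section

namespace PolygonSpace

/-! ### Acyclic connected graphs -/

section Tree

variable {V : Type*} {G : SimpleGraph V}

/-! A closed polygon is a tree of triangles. To a vertex `v` and an incident edge `e` attach the
flag vector, the sum of the sides lying beyond `e` as seen from `v`. The three branches at `v`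
partition the half-edges, so the three flag vectors at `v` form a closed triangle (`balanced_flag`);
the two flag vectors of an internal edge are opposite (`antisymm_flag`). Conversely, by conservation
of flow, a balanced antisymmetric family is recovered from its values at the half-edges
(`flag_tips`). The function `λ_a` is the length of the edge `a` shared by two triangles, so most
questions become local ones about a triangle, glued along the tree by `exists_glue`.

Image: the triangle inequalities are necessary, and triangles with a prescribed first side can be
glued. Fibres: polygons with equal lengths have congruent triangles, conjugate by some `g v` in
`SU(2)`; for neighbouring vertices these elements differ by one fixing the shared edge. Since
stabilizers in `SU(2)` are connected (`isPreconnected_stab`), each fibre is a continuous image of a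
product of connected sets.

Regular points are the polygons whose triangles are all nondegenerate. At each vertex this is an
open condition, and it is dense: after buckling a collinear polygon, rotating two sides about their
sum destroys a persistent degeneracy (`dense_gram_partSum`). At such points the variations of a
triangle have arbitrary derivatives of the side lengths; gluing them yields tangent vectors dual, up
to scale, to the differentials of the `λ_a`. -/

/-- After deletion of the edge `e`, the vertex `p` is still connected to `v`. -/
def Near (G : SimpleGraph V) (v : V) (e : Sym2 V) (p : V) : Prop :=
  (G.deleteEdges {e}).Reachable p v

theorem near_self (v : V) (e : Sym2 V) : Near G v e v := SimpleGraph.Reachable.refl _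

theorem near_of_adj {u p q : V} {e : Sym2 V} (h : G.Adj p q) (he : s(p, q) ≠ e)
    (hq : Near G u e q) : Near G u e p :=
  (SimpleGraph.Adj.reachable (SimpleGraph.deleteEdges_adj.2 ⟨h, he⟩)).trans hq

theorem near_or_near (hc : G.Connected) (v w p : V) :
    Near G v s(v, w) p ∨ Near G w s(v, w) p := by
  suffices H : ∀ z, G.Walk p z → z = v → Near G v s(v, w) p ∨ Near G w s(v, w) p from
    (hc.preconnected p v).elim fun q => H v q rfl
  intro z q hz
  induction q with
  | nil => subst hz; exact Or.inl (near_self _ _)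
  | @cons a b c h q ih =>
    by_cases he : s(a, b) = s(v, w)
    · rcases Sym2.eq_iff.1 he with ⟨rfl, rfl⟩ | ⟨rfl, rfl⟩
      · exact Or.inl (near_self _ _)
      · exact Or.inr (near_self _ _)
    · exact (ih hz).imp (near_of_adj h he) (near_of_adj h he)

theorem not_near_and_near (ha : G.IsAcyclic) {v w : V} (h : G.Adj v w) {p : V}
    (hv : Near G v s(v, w) p) : ¬ Near G w s(v, w) p := fun hw =>
  (SimpleGraph.isBridge_iff.1 (SimpleGraph.isAcyclic_iff_forall_adj_isBridge.1 ha h))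
    (hv.symm.trans hw)

theorem near_iff_not_near (hc : G.Connected) (ha : G.IsAcyclic) {v w : V} (h : G.Adj v w) (p : V) :
    Near G w s(v, w) p ↔ ¬ Near G v s(v, w) p :=
  ⟨fun hw hv => not_near_and_near ha h hv hw, fun hv => (near_or_near hc v w p).resolve_left hv⟩

theorem near_of_walk {p u v : V} {e : Sym2 V} (q : G.Walk p u) (hv : v ∈ e)
    (hq : v ∉ q.support) : Near G u e p := by
  refine ⟨q.toDeleteEdges {e} fun e' he' => ?_⟩
  rintro rfl
  exact hq (q.mem_support_of_mem_edges he' hv)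

theorem exists_path_of_near (ha : G.IsAcyclic) {p u v : V} (h : G.Adj u v)
    (hp : Near G u s(u, v) p) : ∃ q : G.Walk p u, q.IsPath ∧ v ∉ q.support := by
  classical
  obtain ⟨q, hq⟩ := hp.exists_isPath
  refine ⟨q.mapLe (SimpleGraph.deleteEdges_le _), hq.mapLe _, ?_⟩
  rw [SimpleGraph.Walk.support_mapLe_eq_support]
  intro hv
  exact not_near_and_near ha h (near_self u _) (q.dropUntil v hv).reachable.symm

/-- Take the first step of a shortest path from `v` to `p`: the rest avoids `v`, so it survives
deletion of the edge, and acyclicity puts `p` on the far side. The distance clause makes depth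
decrease towards the root in `exists_parent`. -/
theorem exists_neighbor_far (hc : G.Connected) (ha : G.IsAcyclic) {v p : V} (hp : p ≠ v) :
    ∃ w, G.Adj v w ∧ ¬ Near G v s(v, w) p ∧ G.dist w p + 1 = G.dist v p := by
  obtain ⟨q, hq, hl⟩ := hc.exists_path_of_dist v p
  cases q with
  | nil => exact (hp rfl).elim
  | @cons _ w _ h q =>
    rw [SimpleGraph.Walk.cons_isPath_iff] at hq
    rw [SimpleGraph.Walk.length_cons] at hl
    refine ⟨w, h, fun hv => ?_, ?_⟩
    · have hw : Near G w s(v, w) p := near_of_walk q.reverse (Sym2.mem_mk_left v w)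
        (by rw [SimpleGraph.Walk.support_reverse, List.mem_reverse]; exact hq.2)
      exact not_near_and_near ha h hv hw
    · have h1 := SimpleGraph.dist_le q
      have h2 := hc.dist_triangle (u := v) (v := w) (w := p)
      rw [SimpleGraph.dist_eq_one_iff_adj.2 h] at h2
      omega

/-- If `w ≠ w'`, then `p` reaches `w` by a path avoiding `v`, and the step from `w` to `v` does not
use the edge to `w'` either, so that edge would not separate `p` from `v`. -/
theorem neighbor_far_unique (hc : G.Connected) (ha : G.IsAcyclic) {v w w' p : V}
    (h : G.Adj v w) (h' : G.Adj v w') (hp : ¬ Near G v s(v, w) p) (hp' : ¬ Near G v s(v, w') p) :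
    w = w' := by
  by_contra hne
  have h1 : Near G w s(w, v) p := by
    rw [Sym2.eq_swap]; exact (near_iff_not_near hc ha h p).2 hp
  obtain ⟨q, -, hq⟩ := exists_path_of_near ha h.symm h1
  have h2 : Near G w s(v, w') p := near_of_walk q (Sym2.mem_mk_left v w') hq
  refine hp' (h2.trans (near_of_adj h.symm (fun he => ?_) (near_self _ _)))
  rcases Sym2.eq_iff.1 he with ⟨rfl, -⟩ | ⟨rfl, -⟩
  · exact h.ne rfl
  · exact hne rfl

/-- A connected acyclic graph can be rooted. -/
theorem exists_parent (hc : G.Connected) (ha : G.IsAcyclic) :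
    ∃ (r : V) (par : V → V) (depth : V → ℕ), (∀ v, depth v = 0 ↔ v = r) ∧
      (∀ v, v ≠ r → G.Adj (par v) v ∧ depth (par v) + 1 = depth v) ∧
      ∀ v w, G.Adj v w → (w ≠ r ∧ par w = v) ∨ (v ≠ r ∧ par v = w) := by
  classical
  obtain ⟨r⟩ := hc.nonempty
  have key : ∀ v, ∃ w, v ≠ r → G.Adj v w ∧ ¬ Near G v s(v, w) r ∧ G.dist w r + 1 = G.dist v r := by
    intro v
    by_cases h : v = r
    · exact ⟨r, fun h' => (h' h).elim⟩
    · obtain ⟨w, hw⟩ := exists_neighbor_far hc ha (Ne.symm h)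
      exact ⟨w, fun _ => hw⟩
  choose par hpar using key
  refine ⟨r, par, fun v => G.dist v r, fun v => hc.dist_eq_zero_iff,
    fun v hv => ⟨(hpar v hv).1.symm, (hpar v hv).2.2⟩, fun v w h => ?_⟩
  have aux : ∀ v w, G.Adj v w → ¬ Near G v s(v, w) r → v ≠ r ∧ par v = w := by
    intro v w h hn
    have hv : v ≠ r := by rintro rfl; exact hn (near_self _ _)
    exact ⟨hv, neighbor_far_unique hc ha (hpar v hv).1 h (hpar v hv).2.1 hn⟩
  by_cases hn : Near G v s(v, w) r
  · refine Or.inl (aux w v h.symm ?_)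
    rw [Sym2.eq_swap]
    exact not_near_and_near ha h hn
  · exact Or.inr (aux v w h hn)

end Tree

/-! ### Flags -/

namespace HalfEdgeGraph

variable {n : ℕ} {V : Type*} (Γ : HalfEdgeGraph n V)

/-- The half-edges which are separated from the vertex `v` by the edge `e`. -/
def branch (v : V) : Γ.Edge → Set (Fin n)
  | Sum.inl a => {i | ¬ Near Γ.graph v a.1 (Γ.endpoint i)}
  | Sum.inr i => {i}

open Classical in
/-- The sum of the vectors `x i` over the branch at `v` that starts with `e`. -/
def flag (x : Fin n → E3) (v : V) (e : Γ.Edge) : E3 :=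
  ∑ i, if i ∈ Γ.branch v e then x i else 0

/-- The tuple of vectors at the half-edges of a family of vectors on the flags. -/
def tips (z : V → Γ.Edge → E3) (i : Fin n) : E3 := z (Γ.endpoint i) (Sum.inr i)

/-- Families of vectors on the flags which take opposite values on the two flags of each
internal edge. -/
def Antisymm (z : V → Γ.Edge → E3) : Prop :=
  ∀ (v w : V) (h : Γ.graph.Adj v w), z w (Sum.inl ⟨s(v, w), h⟩) = - z v (Sum.inl ⟨s(v, w), h⟩)

variable {Γ}

theorem Admissible.exists_triple (hΓ : Γ.Admissible) (v : V) {e : Γ.Edge} (he : Γ.Incident v e) :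
    ∃ b c, e ≠ b ∧ e ≠ c ∧ b ≠ c ∧ ∀ f, Γ.Incident v f ↔ f = e ∨ f = b ∨ f = c := by
  obtain ⟨x, y, z, hxy, hxz, hyz, h⟩ := Set.ncard_eq_three.1 (hΓ.trivalent v)
  have h' : ∀ f, Γ.Incident v f ↔ f = x ∨ f = y ∨ f = z := fun f => by
    have := Set.ext_iff.1 h f
    simpa using this
  rcases (h' e).1 he with rfl | rfl | rfl
  · exact ⟨y, z, hxy, hxz, hyz, h'⟩
  · exact ⟨x, z, hxy.symm, hyz, hxz, fun f => by rw [h']; tauto⟩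
  · exact ⟨x, y, hxz.symm, hyz.symm, hxy, fun f => by rw [h']; tauto⟩

theorem Admissible.exists_incident (hΓ : Γ.Admissible) (v : V) : ∃ e, Γ.Incident v e := by
  obtain ⟨x, y, z, -, -, -, h⟩ := Set.ncard_eq_three.1 (hΓ.trivalent v)
  exact ⟨x, by change x ∈ {e | Γ.Incident v e}; rw [h]; simp⟩

theorem Admissible.incident_iff (hΓ : Γ.Admissible) {v : V} {a b c : Γ.Edge}
    (ha : Γ.Incident v a) (hb : Γ.Incident v b) (hc : Γ.Incident v c) (hab : a ≠ b) (hbc : b ≠ c)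
    (hac : a ≠ c) (f : Γ.Edge) : Γ.Incident v f ↔ f = a ∨ f = b ∨ f = c := by
  obtain ⟨b', c', h1, h2, h3, h⟩ := hΓ.exists_triple v ha
  have hb' := (h b).1 hb
  have hc' := (h c).1 hc
  rw [h f]
  rcases hb' with rfl | rfl | rfl <;> rcases hc' with rfl | rfl | rfl <;> tauto

/-- The sum over the edges which are incident to `v`. -/
theorem Admissible.sum_incident [Fintype Γ.Edge] [∀ v, DecidablePred (Γ.Incident v)]
    {M : Type*} [AddCommMonoid M] {v : V}
    {a b c : Γ.Edge} (hab : a ≠ b) (hac : a ≠ c) (hbc : b ≠ c)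
    (h : ∀ f, Γ.Incident v f ↔ f = a ∨ f = b ∨ f = c) (z : Γ.Edge → M) :
    ∑ e with Γ.Incident v e, z e = z a + (z b + z c) := by
  classical
  have : Finset.univ.filter (Γ.Incident v) = {a, b, c} := by
    ext f; simp [h]
  rw [this, Finset.sum_insert (by simp [hab, hac]), Finset.sum_pair hbc]

/-- `z` sums to zero over the edges which are incident to `v`. -/
def Balanced (v : V) (z : Γ.Edge → E3) : Prop :=
  ∀ a b c, a ≠ b → a ≠ c → b ≠ c → (∀ f, Γ.Incident v f ↔ f = a ∨ f = b ∨ f = c) →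
    z a + z b + z c = 0

/-- The edge in question is the first one on the way from `v` to the half-edge `i`. Hence the
branches at `v` partition the half-edges. -/
theorem Admissible.existsUnique_branch (hΓ : Γ.Admissible) (v : V) (i : Fin n) :
    ∃! e, Γ.Incident v e ∧ i ∈ Γ.branch v e := by
  by_cases h : Γ.endpoint i = v
  · refine ⟨Sum.inr i, ⟨h, rfl⟩, ?_⟩
    rintro (a | j) ⟨h1, h2⟩
    · exact (h2 (h ▸ near_self _ _)).elim
    · exact congrArg Sum.inr (Eq.symm h2)
  · obtain ⟨w, hw, hn, -⟩ := exists_neighbor_far hΓ.connected hΓ.acyclic h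
    refine ⟨Sum.inl ⟨s(v, w), hw⟩, ⟨Sym2.mem_mk_left v w, hn⟩, ?_⟩
    rintro (⟨a, ha⟩ | j) ⟨h1, h2⟩
    · obtain ⟨w', rfl⟩ := h1
      have := neighbor_far_unique hΓ.connected hΓ.acyclic ha hw h2 hn
      subst this
      rfl
    · have hj : i = j := h2
      exact (h (hj ▸ h1)).elim

theorem Admissible.balanced_flag (hΓ : Γ.Admissible) {x : Fin n → E3} (hx : ∑ i, x i = 0)
    (v : V) : Balanced v (Γ.flag x v) := by
  classical
  intro a b c hab hac hbc h
  unfold flag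
  rw [← Finset.sum_add_distrib, ← Finset.sum_add_distrib]
  refine (Finset.sum_congr rfl fun i _ => ?_).trans hx
  obtain ⟨e, ⟨he, hi⟩, hu⟩ := hΓ.existsUnique_branch v i
  have hu' : ∀ f, Γ.Incident v f → (i ∈ Γ.branch v f ↔ f = e) := fun f hf =>
    ⟨fun hf' => hu f ⟨hf, hf'⟩, fun hf' => hf' ▸ hi⟩
  rw [if_congr (hu' a ((h a).2 (by simp))) rfl rfl, if_congr (hu' b ((h b).2 (by simp))) rfl rfl,
    if_congr (hu' c ((h c).2 (by simp))) rfl rfl]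
  rcases (h e).1 he with rfl | rfl | rfl
  · simp [hab.symm, hac.symm]
  · simp [hab, hbc.symm]
  · simp [hac, hbc]

theorem Admissible.antisymm_flag (hΓ : Γ.Admissible) {x : Fin n → E3} (hx : ∑ i, x i = 0) :
    Γ.Antisymm (Γ.flag x) := by
  classical
  intro v w h
  rw [eq_neg_iff_add_eq_zero, flag, flag, ← Finset.sum_add_distrib]
  refine (Finset.sum_congr rfl fun i _ => ?_).trans hx
  have := near_iff_not_near hΓ.connected hΓ.acyclic h (Γ.endpoint i)
  simp only [branch, mem_ofPred_eq, this]
  by_cases h' : Near Γ.graph v s(v, w) (Γ.endpoint i) <;> simp [h']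

@[simp] theorem flag_inr (x : Fin n → E3) (v : V) (i : Fin n) : Γ.flag x v (Sum.inr i) = x i := by
  simp [flag, branch]

/-! ### Conservation of flow on the tree -/

section Flow

/-- A discrete Stokes formula: an edge not crossing the boundary of `S` has both ends in `S`, where
its flag vectors cancel, or none. -/
theorem sum_flags_endpoints [Fintype V] (z : V → Γ.Edge → E3) (hz : Γ.Antisymm z)
    (S : Finset V) (a : Γ.EInt) (hS : ∀ p q, s(p, q) = a.1 → p ∈ S → q ∈ S)
    [∀ v, DecidablePred (Γ.Incident v)] :
    ∑ p ∈ S, (if Γ.Incident p (Sum.inl a) then z p (Sum.inl a) else 0) = 0 := by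
  classical
  obtain ⟨a, ha⟩ := a
  induction a with
  | h p q =>
    have hpq : p ≠ q := SimpleGraph.Adj.ne ha
    rw [← Finset.sum_filter]
    have hI : ∀ u, Γ.Incident u (Sum.inl ⟨s(p, q), ha⟩) ↔ u = p ∨ u = q := fun u => Sym2.mem_iff
    by_cases hp : p ∈ S
    · have hq := hS p q rfl hp
      have : S.filter (fun u => Γ.Incident u (Sum.inl ⟨s(p, q), ha⟩)) = {p, q} := by
        ext u
        simp only [hI, Finset.mem_filter, Finset.mem_insert, Finset.mem_singleton]
        constructor
        · exact fun h => h.2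
        · rintro (rfl | rfl) <;> simp [*]
      rw [this, Finset.sum_pair hpq, hz p q ha, add_neg_cancel]
    · have hq : q ∉ S := fun h => hp (hS q p Sym2.eq_swap h)
      refine Finset.sum_eq_zero fun u hu => ?_
      rw [Finset.mem_filter, hI] at hu
      rcases hu.2 with rfl | rfl
      · exact (hp hu.1).elim
      · exact (hq hu.1).elim

theorem Admissible.sum_sum_flags (hΓ : Γ.Admissible) [Fintype V] [Fintype Γ.Edge]
    [∀ v, DecidablePred (Γ.Incident v)] {z : V → Γ.Edge → E3} (hb : ∀ v, Balanced v (z v))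
    (S : Finset V) :
    ∑ e, ∑ p ∈ S, (if Γ.Incident p e then z p e else 0) = 0 := by
  classical
  rw [Finset.sum_comm]
  refine Finset.sum_eq_zero fun p _ => ?_
  obtain ⟨e, he⟩ := hΓ.exists_incident p
  obtain ⟨b, c, h1, h2, h3, h⟩ := hΓ.exists_triple p he
  rw [← Finset.sum_filter, Admissible.sum_incident h1 h2 h3 h, ← add_assoc]
  exact hb p e b c h1 h2 h3 h

theorem Admissible.sum_tips_eq (hΓ : Γ.Admissible) [Fintype V] [Fintype Γ.EInt]
    [∀ v, DecidablePred (Γ.Incident v)] {z : V → Γ.Edge → E3} (hb : ∀ v, Balanced v (z v))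
    (S : Finset V) [DecidablePred (· ∈ S)] :
    ∑ a, ∑ p ∈ S, (if Γ.Incident p (Sum.inl a) then z p (Sum.inl a) else 0) +
      ∑ i, (if Γ.endpoint i ∈ S then Γ.tips z i else 0) = 0 := by
  classical
  have := hΓ.sum_sum_flags hb S
  rw [Fintype.sum_sum_type] at this
  refine Eq.trans ?_ this
  congr 1
  refine Finset.sum_congr rfl fun i _ => ?_
  by_cases h : Γ.endpoint i ∈ S
  · rw [if_pos h, Finset.sum_eq_single (Γ.endpoint i)]
    · rw [if_pos (show Γ.Incident (Γ.endpoint i) (Sum.inr i) from rfl)]; rfl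
    · intro p _ hp
      exact if_neg fun h' => hp (Eq.symm h')
    · exact fun h' => (h' h).elim
  · rw [if_neg h, Finset.sum_eq_zero]
    intro p hp
    exact if_neg fun h' => h (show Γ.endpoint i ∈ S from (show Γ.endpoint i = p from h') ▸ hp)

theorem Admissible.sum_tips [Finite V] (hΓ : Γ.Admissible) {z : V → Γ.Edge → E3}
    (hb : ∀ v, Balanced v (z v)) (hz : Γ.Antisymm z) : ∑ i, Γ.tips z i = 0 := by
  classical
  have := Fintype.ofFinite V
  have := Fintype.ofFinite Γ.EInt
  have h := hΓ.sum_tips_eq hb Finset.univ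
  rw [Finset.sum_eq_zero fun a _ => sum_flags_endpoints z hz _ a fun _ _ _ _ => Finset.mem_univ _]
    at h
  simpa using h

/-- Sum the balance over the vertices beyond `e`. Only `e` crosses the boundary of this set, so its
flag vector is determined by the tips there; thus a balanced antisymmetric family is a polygon. -/
theorem Admissible.flag_tips [Finite V] (hΓ : Γ.Admissible) {z : V → Γ.Edge → E3}
    (hb : ∀ v, Balanced v (z v)) (hz : Γ.Antisymm z) {v : V} {e : Γ.Edge}
    (he : Γ.Incident v e) : Γ.flag (Γ.tips z) v e = z v e := by
  classical
  rcases e with ⟨a, ha⟩ | i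
  swap
  · rw [flag_inr, tips, show Γ.endpoint i = v from he]
  obtain ⟨w, rfl⟩ := he
  have hadj : Γ.graph.Adj v w := ha
  have := Fintype.ofFinite V
  have := Fintype.ofFinite Γ.EInt
  set S : Finset V := Finset.univ.filter fun p => ¬ Near Γ.graph v s(v, w) p with hS
  have h := hΓ.sum_tips_eq hb S
  have hvS : v ∉ S := by simp [hS, near_self]
  have hwS : w ∈ S := by
    simp only [hS, Finset.mem_filter, Finset.mem_univ, true_and]
    exact (near_iff_not_near hΓ.connected hΓ.acyclic hadj w).1 (near_self _ _)
  have h1 : ∑ a, ∑ p ∈ S, (if Γ.Incident p (Sum.inl a) then z p (Sum.inl a) else 0) =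
      z w (Sum.inl ⟨s(v, w), ha⟩) := by
    rw [Finset.sum_eq_single ⟨s(v, w), ha⟩]
    · rw [Finset.sum_eq_single w]
      · rw [if_pos (show Γ.Incident w (Sum.inl ⟨s(v, w), ha⟩) from Sym2.mem_mk_right v w)]
      · intro p hp hpw
        refine if_neg fun h' => ?_
        rcases Sym2.mem_iff.1 h' with rfl | rfl
        · exact hvS hp
        · exact hpw rfl
      · exact fun h' => (h' hwS).elim
    · intro a' _ ha'
      refine sum_flags_endpoints z hz S a' fun p q hpq hp => ?_
      simp only [hS, Finset.mem_filter, Finset.mem_univ, true_and] at hp ⊢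
      have hadj' : Γ.graph.Adj p q := by
        have := a'.2
        rwa [← hpq] at this
      refine fun hq => hp (near_of_adj hadj' (fun he => ha' ?_) hq)
      exact Subtype.ext (hpq.symm.trans he)
    · exact fun h' => (h' (Finset.mem_univ _)).elim
  rw [h1, hz v w hadj, neg_add_eq_zero] at h
  rw [h, flag]
  refine Finset.sum_congr rfl fun i _ => ?_
  congr 1
  simp [branch, hS]

end Flow

/-- Local solutions at the vertices which can be matched along the internal edges can be glued. -/
theorem Admissible.exists_glue (hΓ : Γ.Admissible) (P : V → (Γ.Edge → E3) → Prop)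
    (h0 : ∀ v, ∃ z, P v z)
    (hP : ∀ (v w : V) (h : Γ.graph.Adj v w) (z : Γ.Edge → E3), P v z →
      ∃ z', P w z' ∧ z' (Sum.inl ⟨s(v, w), h⟩) = - z (Sum.inl ⟨s(v, w), h⟩)) :
    ∃ z, (∀ v, P v (z v)) ∧ Γ.Antisymm z := by
  classical
  obtain ⟨r, par, depth, hr, hpar, hadj⟩ := exists_parent hΓ.connected hΓ.acyclic
  obtain ⟨z0, hz0⟩ := h0 r
  -- Moving the hypotheses under the existential makes `ext` a total function, available to the
  -- recursion.
  have hex : ∀ (v w : V) (z : Γ.Edge → E3), ∃ z', P v z → ∀ h : Γ.graph.Adj v w,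
      P w z' ∧ z' (Sum.inl ⟨s(v, w), h⟩) = - z (Sum.inl ⟨s(v, w), h⟩) := by
    intro v w z
    by_cases h : P v z ∧ Γ.graph.Adj v w
    · obtain ⟨z', hz'⟩ := hP v w h.2 z h.1
      exact ⟨z', fun _ _ => hz'⟩
    · exact ⟨z, fun h1 h2 => (h ⟨h1, h2⟩).elim⟩
  choose ext hext using hex
  -- `Z k` is meaningful only at vertices of depth `k`; the glued family reads each vertex at its
  -- own depth.
  let Z : ℕ → V → Γ.Edge → E3 := fun k =>
    Nat.rec (fun _ => z0) (fun _ Zk v => ext (par v) v (Zk (par v))) k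
  have hZ : ∀ k v, depth v = k → P v (Z k v) := by
    intro k
    induction k with
    | zero => intro v hv; rw [hr] at hv; subst hv; exact hz0
    | succ k ih =>
      intro v hv
      have hv' : v ≠ r := fun h => by rw [(hr v).2 h] at hv; omega
      obtain ⟨h1, h2⟩ := hpar v hv'
      exact (hext _ _ _ (ih (par v) (by omega)) h1).1
  have hstep : ∀ v w (h : Γ.graph.Adj v w), w ≠ r → par w = v →
      Z (depth w) w (Sum.inl ⟨s(v, w), h⟩) = - Z (depth v) v (Sum.inl ⟨s(v, w), h⟩) := by
    rintro v w h hw rfl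
    rw [← (hpar w hw).2]
    exact (hext _ _ _ (hZ _ (par w) rfl) h).2
  refine ⟨fun v => Z (depth v) v, fun v => hZ _ v rfl, fun v w h => ?_⟩
  rcases hadj v w h with ⟨h1, h2⟩ | ⟨h1, h2⟩
  · exact hstep v w h h1 h2
  · have := hstep w v h.symm h1 h2
    have he : (⟨s(v, w), h⟩ : Γ.EInt) = ⟨s(w, v), h.symm⟩ := Subtype.ext Sym2.eq_swap
    rw [eq_comm, neg_eq_iff_eq_neg, he]
    exact this

/-- Reaching the initial vertex while avoiding the terminal one amounts to being cut off from the
terminal vertex by `a`. So `λ_a` is the norm of a flag vector. -/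
theorem Admissible.side_eq (hΓ : Γ.Admissible) (o : Γ.Orientation) (a : Γ.EInt) :
    o.side a = Γ.branch (o.dart a).snd (Sum.inl a) := by
  have hadj := (o.dart a).adj
  have he : s((o.dart a).fst, (o.dart a).snd) = a.1 := o.edge_dart a
  ext i
  simp only [Orientation.side, branch, mem_ofPred_eq, ← he]
  rw [Sym2.eq_swap, ← near_iff_not_near hΓ.connected hΓ.acyclic hadj.symm, Sym2.eq_swap]
  constructor
  · rintro ⟨p, -, hp⟩
    exact near_of_walk p (Sym2.mem_mk_right _ _) hp
  · exact exists_path_of_near hΓ.acyclic hadj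

end HalfEdgeGraph

/-! ### Gram determinants of pairs of vectors -/

section Gram

variable {E : Type*} [NormedAddCommGroup E] [InnerProductSpace ℝ E]

/-- The Gram determinant of two vectors. -/
def gram (a b : E) : ℝ := ‖a‖ ^ 2 * ‖b‖ ^ 2 - ⟪a, b⟫ ^ 2

theorem gram_comm (a b : E) : gram a b = gram b a := by
  rw [gram, gram, real_inner_comm, mul_comm]

theorem gram_smul_smul (s t : ℝ) (u : E) : gram (s • u) (t • u) = 0 := by
  rw [gram, inner_smul_left, inner_smul_right, real_inner_self_eq_norm_sq, norm_smul, norm_smul,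
    mul_pow, mul_pow, Real.norm_eq_abs, Real.norm_eq_abs, sq_abs, sq_abs]
  simp only [conj_trivial]
  ring

theorem gram_zero_left (b : E) : gram 0 b = 0 := by simp [gram]

theorem ne_zero_of_gram {a b : E} (h : gram a b ≠ 0) : a ≠ 0 := by
  rintro rfl
  exact h (gram_zero_left b)

theorem exists_smul_of_gram_eq_zero {a b : E} (ha : a ≠ 0) (h : gram a b = 0) :
    ∃ r : ℝ, b = r • a := by
  have hn : ‖a‖ ^ 2 ≠ 0 := by simpa using ha
  refine ⟨⟪a, b⟫ / ‖a‖ ^ 2, ?_⟩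
  rw [← sub_eq_zero, ← norm_eq_zero, ← sq_eq_zero_iff, norm_sub_sq_real, norm_smul, mul_pow,
    Real.norm_eq_abs, sq_abs, inner_smul_right, real_inner_comm a b]
  rw [gram] at h
  field_simp
  linear_combination h

theorem gram_of_sum_eq_zero {a b c : E} (h : a + b + c = 0) : gram a c = gram a b := by
  rw [show c = -(a + b) by rw [eq_neg_iff_add_eq_zero, ← h]; abel]
  rw [gram, gram, norm_neg, norm_add_sq_real, inner_neg_right, inner_add_right,
    real_inner_self_eq_norm_sq]
  ring

/-- Heron's formula: `gram a b` is four times the squared area of the triangle. Strict triangle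
inequalities thus express nondegeneracy. -/
theorem four_mul_gram {a b c : E} (h : a + b + c = 0) :
    4 * gram a b = ((‖a‖ + ‖b‖) ^ 2 - ‖c‖ ^ 2) * (‖c‖ ^ 2 - (‖a‖ - ‖b‖) ^ 2) := by
  rw [show c = -(a + b) by rw [eq_neg_iff_add_eq_zero, ← h]; abel]
  rw [gram, norm_neg, norm_add_sq_real]
  ring

theorem triangle_of_sum_eq_zero {E : Type*} [NormedAddCommGroup E] {a b c : E} (h : a + b + c = 0) :
    |‖a‖ - ‖b‖| ≤ ‖c‖ ∧ ‖c‖ ≤ ‖a‖ + ‖b‖ := by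
  rw [show c = -(a + b) by rw [eq_neg_iff_add_eq_zero, ← h]; abel, norm_neg]
  refine ⟨?_, norm_add_le a b⟩
  simpa using abs_norm_sub_norm_le a (-b)

theorem gram_ne_zero_iff {a b c : E} (h : a + b + c = 0) :
    gram a b ≠ 0 ↔ |‖a‖ - ‖b‖| < ‖c‖ ∧ ‖c‖ < ‖a‖ + ‖b‖ := by
  obtain ⟨h1, h2⟩ := triangle_of_sum_eq_zero h
  have h4 := four_mul_gram h
  constructor
  · intro hg
    refine ⟨lt_of_le_of_ne h1 fun he => hg ?_, lt_of_le_of_ne h2 fun he => hg ?_⟩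
    · rw [← he, sq_abs, sub_self, mul_zero] at h4
      linarith
    · rw [← he, sub_self, zero_mul] at h4
      linarith
  · rintro ⟨h5, h6⟩ hg
    have h7 := pow_lt_pow_left₀ h5 (abs_nonneg _) two_ne_zero
    have h8 := pow_lt_pow_left₀ h6 (norm_nonneg _) two_ne_zero
    rw [sq_abs] at h7
    have := mul_pos (sub_pos.2 h8) (sub_pos.2 h7)
    rw [← h4, hg] at this
    simp at this

/-- Cramer's rule in the plane spanned by `a` and `b`. -/
theorem exists_inner_eq {a b : E} (h : gram a b ≠ 0) (s t : ℝ) :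
    ∃ w : E, ⟪a, w⟫ = s ∧ ⟪b, w⟫ = t := by
  refine ⟨((s * ‖b‖ ^ 2 - t * ⟪a, b⟫) / gram a b) • a + ((t * ‖a‖ ^ 2 - s * ⟪a, b⟫) / gram a b) • b,
    ?_, ?_⟩ <;>
  · rw [inner_add_right, inner_smul_right, inner_smul_right, real_inner_self_eq_norm_sq]
    try rw [real_inner_comm a b]
    field_simp
    rw [gram]
    ring

theorem continuous_gram : Continuous fun p : E × E => gram p.1 p.2 := by
  unfold gram
  fun_prop

end Gram

/-! ### Vectors in three-space -/

theorem E3.one_lt_rank : 1 < Module.rank ℝ E3 := by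
  rw [← Module.finrank_eq_rank]
  simp

theorem inner_E3 (x y : E3) : ⟪x, y⟫ = x 0 * y 0 + x 1 * y 1 + x 2 * y 2 := by
  simp [PiLp.inner_apply, Fin.sum_univ_three, mul_comm]

theorem exists_unit_smul (u : E3) : ∃ v : E3, ‖v‖ = 1 ∧ u = ‖u‖ • v := by
  by_cases h : u = 0
  · obtain ⟨v, hv⟩ := exists_norm_eq E3 (c := 1) zero_le_one
    exact ⟨v, hv, by simp [h]⟩
  · have hn : ‖u‖ ≠ 0 := norm_ne_zero_iff.2 h
    exact ⟨‖u‖⁻¹ • u, by rw [norm_smul, norm_inv, norm_norm, inv_mul_cancel₀ hn],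
      by rw [smul_smul, mul_inv_cancel₀ hn, one_smul]⟩

/-- Triangles with given side lengths exist, with a prescribed first side. -/
theorem exists_triangle (u : E3) {β γ : ℝ} (hβ : 0 ≤ β) (h1 : |‖u‖ - β| ≤ γ)
    (h2 : γ ≤ ‖u‖ + β) : ∃ y : E3, ‖y‖ = β ∧ ‖u + y‖ = γ := by
  obtain ⟨v, hv, hu⟩ := exists_unit_smul u
  have hp := isPreconnected_sphere E3.one_lt_rank (0 : E3) β
  have hmem : ∀ s : ℝ, |s| = β → s • v ∈ Metric.sphere (0 : E3) β := fun s hs => by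
    rw [mem_sphere_zero_iff_norm, norm_smul, hv, mul_one, Real.norm_eq_abs, hs]
  have hval : ∀ s : ℝ, ‖u + s • v‖ = |‖u‖ + s| := fun s => by
    conv_lhs => rw [hu, ← add_smul, norm_smul, hv, mul_one, Real.norm_eq_abs]
  -- The two collinear positions of `y` realize the extreme values of the third side, and the sphere
  -- is connected.
  have := hp.intermediate_value (hmem (-β) (by rw [abs_neg, abs_of_nonneg hβ]))
    (hmem β (abs_of_nonneg hβ)) (f := fun y => ‖u + y‖) (by fun_prop)
  have hγ : γ ∈ Icc ‖u + (-β) • v‖ ‖u + β • v‖ := by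
    rw [hval, hval, abs_of_nonneg (add_nonneg (norm_nonneg u) hβ)]
    exact ⟨h1, h2⟩
  obtain ⟨y, hy, hy'⟩ := this hγ
  exact ⟨y, mem_sphere_zero_iff_norm.1 hy, hy'⟩

theorem exists_unit_orthogonal (a b : E3) : ∃ u : E3, ‖u‖ = 1 ∧ ⟪u, a⟫ = 0 ∧ ⟪u, b⟫ = 0 := by
  classical
  set K : Submodule ℝ E3 := Submodule.span ℝ (({a, b} : Finset E3) : Set E3)
  have h1 : Module.finrank ℝ K ≤ 2 :=
    (finrank_span_finset_le_card _).trans Finset.card_le_two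
  have h2 := K.finrank_add_finrank_orthogonal
  have h3 : Module.finrank ℝ E3 = 3 := by simp
  have h4 : Kᗮ ≠ ⊥ := fun h => by
    rw [h, finrank_bot] at h2
    omega
  obtain ⟨x, hx, hx0⟩ := Submodule.exists_mem_ne_zero_of_ne_bot h4
  obtain ⟨u, hu, hxu⟩ := exists_unit_smul x
  have hn : ‖x‖ ≠ 0 := norm_ne_zero_iff.2 hx0
  refine ⟨u, hu, ?_, ?_⟩
  all_goals
    refine (mul_eq_zero.1 ?_).resolve_left hn
    rw [← real_inner_smul_left, ← hxu]
    exact (Submodule.mem_orthogonal' _ _).1 hx _ (Submodule.subset_span (by simp))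

/-- Vectors of the same norm are exchanged by a reflection, which can be chosen to fix a vector
with which they have the same inner product. -/
theorem exists_reflection {a b b' : E3} (hn : ‖b‖ = ‖b'‖) (hi : ⟪a, b⟫ = ⟪a, b'⟫) :
    ∃ u : E3, ‖u‖ = 1 ∧ ⟪u, a⟫ = 0 ∧ b - (2 * ⟪u, b⟫) • u = b' := by
  by_cases h : b = b'
  · obtain ⟨u, hu, ha, hb⟩ := exists_unit_orthogonal a b
    exact ⟨u, hu, ha, by rw [hb, mul_zero, zero_smul, sub_zero, h]⟩
  · obtain ⟨u, hu, hd⟩ := exists_unit_smul (b - b')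
    have hne : ‖b - b'‖ ≠ 0 := norm_ne_zero_iff.2 (sub_ne_zero.2 h)
    refine ⟨u, hu, ?_, ?_⟩
    · refine (mul_eq_zero.1 ?_).resolve_left hne
      rw [← real_inner_smul_left, ← hd, inner_sub_left, real_inner_comm, real_inner_comm a b', hi,
        sub_self]
    · have h2 : 2 * ⟪b - b', b⟫ = ‖b - b'‖ ^ 2 := by
        rw [norm_sub_sq_real, ← hn, inner_sub_left, real_inner_self_eq_norm_sq,
          real_inner_comm b b']
        ring
      have h3 : 2 * ⟪u, b⟫ = ‖b - b'‖ := by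
        refine mul_left_cancel₀ hne ?_
        rw [← sq, ← h2]
        conv_rhs => rw [hd, real_inner_smul_left]
        ring
      rw [h3, ← hd]
      abel

/-! ### The adjoint action -/

/-- Complex two by two matrices. -/
abbrev M2 : Type := Matrix (Fin 2) (Fin 2) ℂ

/-- The underlying set of `SU(2)`. -/
def SU2 : Set M2 := {g | g ∈ Matrix.specialUnitaryGroup (Fin 2) ℂ}

/-- The left inverse of `toSu2`. -/
def fromSu2 (A : M2) : E3 := !₂[(A 0 1).im, (A 0 1).re, (A 0 0).im]

theorem fromSu2_toSu2 (x : E3) : fromSu2 (toSu2 x) = x := by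
  ext i
  fin_cases i <;> simp [fromSu2, toSu2]

theorem toSu2_injective : Function.Injective toSu2 :=
  Function.LeftInverse.injective fromSu2_toSu2

theorem toSu2_fromSu2 {A : M2} (h1 : star A = -A) (h2 : A.trace = 0) :
    toSu2 (fromSu2 A) = A := by
  obtain ⟨x, rfl⟩ : A ∈ Set.range toSu2 := by rw [range_toSu2]; exact ⟨h1, h2⟩
  rw [fromSu2_toSu2]

theorem continuous_fromSu2 : Continuous fromSu2 := by
  refine (PiLp.continuous_toLp 2 _).comp (continuous_pi fun i => ?_)
  fin_cases i
  · exact Complex.continuous_im.comp (continuous_apply_apply 0 1)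
  · exact Complex.continuous_re.comp (continuous_apply_apply 0 1)
  · exact Complex.continuous_im.comp (continuous_apply_apply 0 0)

theorem toSu2_mem (x : E3) : star (toSu2 x) = - toSu2 x ∧ (toSu2 x).trace = 0 := by
  have : toSu2 x ∈ Set.range toSu2 := ⟨x, rfl⟩
  rwa [range_toSu2] at this

theorem SU2.star_mul {g : M2} (hg : g ∈ SU2) : star g * g = 1 :=
  Matrix.mem_unitaryGroup_iff'.1 (Matrix.mem_specialUnitaryGroup_iff.1 hg).1

theorem SU2.mul_star {g : M2} (hg : g ∈ SU2) : g * star g = 1 :=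
  Matrix.mem_unitaryGroup_iff.1 (Matrix.mem_specialUnitaryGroup_iff.1 hg).1

theorem SU2.mul_mem {g h : M2} (hg : g ∈ SU2) (hh : h ∈ SU2) : g * h ∈ SU2 :=
  (Matrix.specialUnitaryGroup (Fin 2) ℂ).mul_mem hg hh

theorem SU2.star_mem {g : M2} (hg : g ∈ SU2) : star g ∈ SU2 :=
  (star (⟨g, hg⟩ : Matrix.specialUnitaryGroup (Fin 2) ℂ)).2

theorem SU2.one_mem : (1 : M2) ∈ SU2 := (Matrix.specialUnitaryGroup (Fin 2) ℂ).one_mem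

/-- The adjoint action. -/
def ad (g : M2) (x : E3) : E3 := fromSu2 (g * toSu2 x * star g)

theorem toSu2_ad {g : M2} (hg : g ∈ SU2) (x : E3) : toSu2 (ad g x) = g * toSu2 x * star g := by
  obtain ⟨h1, h2⟩ := toSu2_mem x
  refine toSu2_fromSu2 ?_ ?_
  · rw [star_mul, star_mul, star_star, h1, neg_mul, mul_neg, mul_assoc]
  · rw [Matrix.trace_mul_comm, ← mul_assoc, SU2.star_mul hg, one_mul, h2]

theorem ad_mul (g : M2) {h : M2} (hh : h ∈ SU2) (x : E3) : ad (g * h) x = ad g (ad h x) := by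
  rw [ad, ad, toSu2_ad hh, star_mul]
  simp only [mul_assoc]

theorem ad_one (x : E3) : ad 1 x = x := by simp [ad, fromSu2_toSu2]

theorem norm_ad {g : M2} (hg : g ∈ SU2) (x : E3) : ‖ad g x‖ = ‖x‖ :=
  norm_eq_of_conj ⟨g, hg⟩ _ _ (toSu2_ad hg x)

theorem ad_add {g : M2} (hg : g ∈ SU2) (x y : E3) : ad g (x + y) = ad g x + ad g y :=
  toSu2_injective <| by
    rw [map_add, toSu2_ad hg, toSu2_ad hg, toSu2_ad hg, map_add, mul_add, add_mul]

theorem ad_neg {g : M2} (hg : g ∈ SU2) (x : E3) : ad g (-x) = - ad g x :=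
  toSu2_injective <| by
    rw [map_neg, toSu2_ad hg, toSu2_ad hg, map_neg, mul_neg, neg_mul]

theorem ad_zero {g : M2} (hg : g ∈ SU2) : ad g 0 = 0 :=
  toSu2_injective <| by rw [map_zero, toSu2_ad hg, map_zero, mul_zero, zero_mul]

theorem ad_star_ad {g : M2} (hg : g ∈ SU2) (x : E3) : ad (star g) (ad g x) = x := by
  rw [← ad_mul _ hg, SU2.star_mul hg, ad_one]

theorem continuous_ad (x : E3) : Continuous fun g => ad g x :=
  continuous_fromSu2.comp (by fun_prop)

theorem toSu2_mem_SU2 {u : E3} (hu : ‖u‖ = 1) : toSu2 u ∈ SU2 := by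
  have h1 : u 0 ^ 2 + u 1 ^ 2 + u 2 ^ 2 = 1 := by
    have := EuclideanSpace.real_norm_sq_eq u
    rw [hu, Fin.sum_univ_three] at this
    linarith
  have h2 : (u 0 : ℂ) ^ 2 + (u 1 : ℂ) ^ 2 + (u 2 : ℂ) ^ 2 = 1 := by
    simpa using congrArg Complex.ofReal h1
  refine Matrix.mem_specialUnitaryGroup_iff.2 ⟨Matrix.mem_unitaryGroup_iff.2 ?_, ?_⟩
  · rw [(toSu2_mem u).1]
    ext i j
    fin_cases i <;> fin_cases j <;> simp [toSu2, Matrix.mul_apply, Fin.sum_univ_two]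
    · linear_combination h2 - ((u 0 : ℂ) ^ 2 + (u 2 : ℂ) ^ 2) * Complex.I_sq
    · ring
    · ring
    · linear_combination h2 - ((u 0 : ℂ) ^ 2 + (u 2 : ℂ) ^ 2) * Complex.I_sq
  · simp [toSu2, Matrix.det_fin_two]
    linear_combination h2 - ((u 0 : ℂ) ^ 2 + (u 2 : ℂ) ^ 2) * Complex.I_sq

/-- A pure unit quaternion acts as the half-turn about its axis, which is minus a reflection. This
brings reflections into `SU(2)`. -/
theorem ad_toSu2 {u : E3} (hu : ‖u‖ = 1) (x : E3) :
    ad (toSu2 u) x = - (x - (2 * ⟪u, x⟫) • u) := by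
  have h1 : u 0 ^ 2 + u 1 ^ 2 + u 2 ^ 2 = 1 := by
    have := EuclideanSpace.real_norm_sq_eq u
    rw [hu, Fin.sum_univ_three] at this
    linarith
  rw [ad, (toSu2_mem u).1, inner_E3]
  ext i
  fin_cases i <;> simp [fromSu2, toSu2, Matrix.mul_apply, Fin.sum_univ_two]
  · linear_combination (-x 0) * h1
  · linear_combination (-x 1) * h1
  · linear_combination (-x 2) * h1

/-- Pairs of vectors with the same Gram matrix are conjugate. -/
theorem exists_ad_pair {a b a' b' : E3} (ha : ‖a‖ = ‖a'‖) (hb : ‖b‖ = ‖b'‖)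
    (hab : ⟪a, b⟫ = ⟪a', b'⟫) : ∃ g ∈ SU2, ad g a = a' ∧ ad g b = b' := by
  -- One reflection takes `a` to `a'`, a second one fixes `a'` and corrects the image of `b`; the
  -- two signs from the half-turns cancel.
  obtain ⟨u, hu, -, h1⟩ := exists_reflection (a := 0) ha (by simp)
  set b1 := b - (2 * ⟪u, b⟫) • u with hb1
  have hg1 := ad_toSu2 hu a
  have hg2 := ad_toSu2 hu b
  rw [h1] at hg1
  rw [← hb1] at hg2
  have hinner : ⟪a', b1⟫ = ⟪a, b⟫ := by
    have huu : ⟪u, u⟫ = 1 := by rw [real_inner_self_eq_norm_sq, hu, one_pow]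
    rw [hb1, ← h1]
    simp only [inner_sub_left, inner_sub_right, inner_smul_left, inner_smul_right, conj_trivial,
      huu, real_inner_comm u a]
    ring
  have hnorm : ‖b1‖ = ‖b'‖ := by
    rw [← hb, ← norm_ad (toSu2_mem_SU2 hu) b, hg2, norm_neg]
  obtain ⟨v, hv, hva, hvb⟩ := exists_reflection hnorm (hinner.trans hab)
  refine ⟨toSu2 v * toSu2 u, SU2.mul_mem (toSu2_mem_SU2 hv) (toSu2_mem_SU2 hu), ?_, ?_⟩
  · rw [ad_mul _ (toSu2_mem_SU2 hu), hg1, ad_neg (toSu2_mem_SU2 hv), ad_toSu2 hv, hva]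
    simp
  · rw [ad_mul _ (toSu2_mem_SU2 hu), hg2, ad_neg (toSu2_mem_SU2 hv), ad_toSu2 hv, hvb, neg_neg]

/-- Congruent triangles are conjugate. -/
theorem exists_ad_triple {a b c a' b' c' : E3} (h : a + b + c = 0) (h' : a' + b' + c' = 0)
    (ha : ‖a‖ = ‖a'‖) (hb : ‖b‖ = ‖b'‖) (hc : ‖c‖ = ‖c'‖) :
    ∃ g ∈ SU2, ad g a = a' ∧ ad g b = b' ∧ ad g c = c' := by
  have e : c = -(a + b) := by rw [eq_neg_iff_add_eq_zero, ← h]; abel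
  have e' : c' = -(a' + b') := by rw [eq_neg_iff_add_eq_zero, ← h']; abel
  have hab : ⟪a, b⟫ = ⟪a', b'⟫ := by
    have h1 := norm_add_sq_real a b
    have h2 := norm_add_sq_real a' b'
    rw [← norm_neg, ← e, hc, ha, hb] at h1
    rw [← norm_neg, ← e'] at h2
    linarith
  obtain ⟨g, hg, h1, h2⟩ := exists_ad_pair ha hb hab
  exact ⟨g, hg, h1, h2, by rw [e, e', ad_neg hg, ad_add hg, h1, h2]⟩

/-! ### Stabilizers -/

/-- The stabilizer of a vector in `SU(2)`. -/
def stab (u : E3) : Set M2 := {g ∈ SU2 | ad g u = u}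

/-- Euclidean four-space as the algebra of quaternions. -/
def quat : EuclideanSpace ℝ (Fin 4) →ₗ[ℝ] M2 where
  toFun q := !![(q 0 : ℂ) + Complex.I * q 3, (q 2 : ℂ) + Complex.I * q 1;
    -(q 2 : ℂ) + Complex.I * q 1, (q 0 : ℂ) - Complex.I * q 3]
  map_add' x y := by
    ext i j
    fin_cases i <;> fin_cases j <;> simp <;> ring
  map_smul' c x := by
    ext i j
    fin_cases i <;> fin_cases j <;> simp <;> ring

/-- The description of `SU(2)` as the unit quaternions turns stabilizers into spheres of linear
subspaces. -/
theorem quat_image_sphere : quat '' Metric.sphere 0 1 = SU2 := by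
  ext g
  constructor
  · rintro ⟨q, hq, rfl⟩
    rw [mem_sphere_zero_iff_norm] at hq
    have h1 : q 0 ^ 2 + q 1 ^ 2 + q 2 ^ 2 + q 3 ^ 2 = 1 := by
      have := EuclideanSpace.real_norm_sq_eq q
      rw [hq, Fin.sum_univ_four] at this
      linarith
    have h2 : (q 0 : ℂ) ^ 2 + (q 1 : ℂ) ^ 2 + (q 2 : ℂ) ^ 2 + (q 3 : ℂ) ^ 2 = 1 := by
      simpa using congrArg Complex.ofReal h1
    refine Matrix.mem_specialUnitaryGroup_iff.2 ⟨Matrix.mem_unitaryGroup_iff.2 ?_, ?_⟩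
    · ext i j
      fin_cases i <;> fin_cases j <;>
        simp [quat, Matrix.mul_apply, Fin.sum_univ_two, Matrix.star_apply]
      · linear_combination h2 - ((q 1 : ℂ) ^ 2 + (q 3 : ℂ) ^ 2) * Complex.I_sq
      · ring
      · ring
      · linear_combination h2 - ((q 1 : ℂ) ^ 2 + (q 3 : ℂ) ^ 2) * Complex.I_sq
    · simp [quat, Matrix.det_fin_two]
      linear_combination h2 - ((q 1 : ℂ) ^ 2 + (q 3 : ℂ) ^ 2) * Complex.I_sq
  · intro hg
    have hdet := (Matrix.mem_specialUnitaryGroup_iff.1 hg).2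
    have hstar : star g = g.adjugate := by
      have h1 : g * g.adjugate = 1 := by rw [Matrix.mul_adjugate, hdet, one_smul]
      calc star g = star g * (g * g.adjugate) := by rw [h1, mul_one]
        _ = g.adjugate := by rw [← mul_assoc, SU2.star_mul hg, one_mul]
    have h00 := congrFun (congrFun hstar 0) 0
    have h10 := congrFun (congrFun hstar 1) 0
    rw [Matrix.adjugate_fin_two] at h00 h10
    simp only [Matrix.star_apply, Complex.star_def, Matrix.of_apply, Matrix.cons_val',
      Matrix.cons_val_zero, Matrix.cons_val_one, Matrix.cons_val_fin_one, Complex.ext_iff,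
      Complex.conj_re, Complex.conj_im, Complex.neg_re, Complex.neg_im] at h00 h10
    rw [Matrix.det_fin_two, Complex.ext_iff] at hdet
    simp only [Complex.sub_re, Complex.mul_re, Complex.one_re] at hdet
    refine ⟨!₂[(g 0 0).re, (g 0 1).im, (g 0 1).re, (g 0 0).im], ?_, ?_⟩
    · rw [mem_sphere_zero_iff_norm, ← sq_eq_sq₀ (norm_nonneg _) zero_le_one,
        EuclideanSpace.real_norm_sq_eq, Fin.sum_univ_four]
      simp
      have := hdet.1
      rw [← h00.1, ← h00.2] at this
      have e1 : (g 1 0).re = -(g 0 1).re := by linarith [h10.1]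
      have e2 : (g 1 0).im = (g 0 1).im := by linarith [h10.2]
      rw [e1, e2] at this
      linarith
    · ext i j
      fin_cases i <;> fin_cases j <;> simp [quat, Complex.ext_iff] <;>
        first | done | (constructor <;> linarith [h00.1, h00.2, h10.1, h10.2])

theorem ad_eq_iff {g : M2} (hg : g ∈ SU2) (u : E3) :
    ad g u = u ↔ g * toSu2 u = toSu2 u * g := by
  rw [← toSu2_injective.eq_iff, toSu2_ad hg]
  constructor
  · intro h
    conv_rhs => rw [← h]
    rw [mul_assoc _ _ g, SU2.star_mul hg, mul_one]
  · intro h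
    rw [h, mul_assoc, SU2.mul_star hg, mul_one]

/-- Fixing `u` means commuting with `toSu2 u`, a linear condition on quaternions. Its solutions
include `1` and the axis of `u`, so they have dimension at least two and their unit sphere is
connected. -/
theorem isPreconnected_stab (u : E3) : IsPreconnected (stab u) := by
  let W : Submodule ℝ (EuclideanSpace ℝ (Fin 4)) :=
    LinearMap.ker ((LinearMap.mulRight ℝ (toSu2 u) - LinearMap.mulLeft ℝ (toSu2 u)) ∘ₗ quat)
  have hW : ∀ q, q ∈ W ↔ quat q * toSu2 u = toSu2 u * quat q := fun q => by
    simp [W, sub_eq_zero]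
  -- Replacing `u` by a nonzero `u'` on its line also covers `u = 0`, where degenerate triangles
  -- lead.
  obtain ⟨u', hu', c, hc⟩ : ∃ u' : E3, u' ≠ 0 ∧ ∃ c : ℝ, u = c • u' := by
    obtain ⟨v, hv, h⟩ := exists_unit_smul u
    exact ⟨v, by rintro rfl; simp at hv, _, h⟩
  have h1 : !₂[1, 0, 0, 0] ∈ W := by
    rw [hW, show quat !₂[1, 0, 0, 0] = 1 by
      ext i j; fin_cases i <;> fin_cases j <;> simp [quat], one_mul, mul_one]
  have h2 : !₂[0, u' 0, u' 1, u' 2] ∈ W := by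
    rw [hW, show quat !₂[0, u' 0, u' 1, u' 2] = toSu2 u' by
      ext i j; fin_cases i <;> fin_cases j <;> simp [quat, toSu2], hc, map_smul, mul_smul_comm,
      smul_mul_assoc]
  have hli : LinearIndependent ℝ ![(⟨_, h1⟩ : W), ⟨_, h2⟩] := by
    rw [LinearIndependent.pair_iff]
    intro s t hst
    have hst' := congrArg (fun w : W => (w : EuclideanSpace ℝ (Fin 4))) hst
    have e0 := congrArg (fun q : EuclideanSpace ℝ (Fin 4) => q 0) hst'
    have e1 := congrArg (fun q : EuclideanSpace ℝ (Fin 4) => q 1) hst'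
    have e2 := congrArg (fun q : EuclideanSpace ℝ (Fin 4) => q 2) hst'
    have e3 := congrArg (fun q : EuclideanSpace ℝ (Fin 4) => q 3) hst'
    simp at e0 e1 e2 e3
    refine ⟨e0, ?_⟩
    by_contra ht
    refine hu' ?_
    ext i
    fin_cases i
    · simpa using e1.resolve_left ht
    · simpa using e2.resolve_left ht
    · simpa using e3.resolve_left ht
  have hrank : 1 < Module.rank ℝ W := by
    rw [← Module.finrank_eq_rank]
    have := hli.fintype_card_le_finrank
    rw [Fintype.card_fin] at this
    exact_mod_cast this
  have hs := (isPreconnected_sphere hrank (0 : W) 1).image (fun w => quat w)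
    ((LinearMap.continuous_of_finiteDimensional quat).comp continuous_subtype_val).continuousOn
  convert hs using 1
  ext g
  constructor
  · rintro ⟨hg, hgu⟩
    rw [ad_eq_iff hg] at hgu
    rw [← quat_image_sphere] at hg
    obtain ⟨q, hq, rfl⟩ := hg
    exact ⟨⟨q, (hW q).2 hgu⟩, by simpa using hq, rfl⟩
  · rintro ⟨⟨q, hqW⟩, hq, rfl⟩
    have hg : quat q ∈ SU2 := by
      rw [← quat_image_sphere]
      exact ⟨q, by simpa using hq, rfl⟩
    exact ⟨hg, (ad_eq_iff hg u).2 ((hW q).1 hqW)⟩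

/-- Products along the paths which start at the root of a rooted tree. -/
theorem exists_path_product {V : Type*} {G : SimpleGraph V} (hc : G.Connected) (ha : G.IsAcyclic)
    {M : Type*} [Monoid M] [TopologicalSpace M] [ContinuousMul M] :
    ∃ (r : V) (par : V → V) (R : (V → M) → V → M), (∀ v, v ≠ r → G.Adj (par v) v) ∧
      (∀ v w, G.Adj v w → (w ≠ r ∧ par w = v) ∨ (v ≠ r ∧ par v = w)) ∧
      (∀ v, Continuous fun S => R S v) ∧
      (∀ S v, v ≠ r → R S v = R S (par v) * S v) ∧
      (∀ (N : Set M) S, (∀ a ∈ N, ∀ b ∈ N, a * b ∈ N) → (∀ v, S v ∈ N) → ∀ v, R S v ∈ N) ∧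
      ∀ S g : V → M, S r = g r → (∀ v, v ≠ r → g v = g (par v) * S v) → ∀ v, R S v = g v := by
  obtain ⟨r, par, depth, hr, hpar, hadj⟩ := exists_parent hc ha
  -- `R k S v` multiplies the values of `S` from the `k`-th ancestor of `v` down to `v`; `k = depth
  -- v` starts the product at the root.
  let R : ℕ → (V → M) → V → M := fun k S =>
    Nat.rec (fun v => S v) (fun _ Rk v => Rk (par v) * S v) k
  have hind : ∀ {P : V → Prop}, P r → (∀ v, v ≠ r → P (par v) → P v) → ∀ v, P v := by
    intro P h0 h1
    suffices h : ∀ k v, depth v = k → P v from fun v => h _ v rfl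
    intro k
    induction k with
    | zero => intro v hv; rw [hr] at hv; exact hv ▸ h0
    | succ k ih =>
      intro v hv
      have hv' : v ≠ r := fun h => by rw [(hr v).2 h] at hv; omega
      exact h1 v hv' (ih _ (by have := (hpar v hv').2; omega))
  have hstep : ∀ S v, v ≠ r → R (depth v) S v = R (depth (par v)) S (par v) * S v := by
    intro S v hv
    rw [← (hpar v hv).2]
  have hroot : ∀ S, R (depth r) S r = S r := fun S => by
    rw [(hr r).2 rfl]
    rfl
  refine ⟨r, par, fun S v => R (depth v) S v, fun v hv => (hpar v hv).1, hadj, ?_, hstep, ?_, ?_⟩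
  · refine hind ?_ ?_
    · simp only [hroot]
      exact continuous_apply r
    · intro v hv h
      simp only [hstep _ v hv]
      exact h.mul (continuous_apply v)
  · intro N S hN hS
    refine hind ?_ ?_
    · simp only [hroot]
      exact hS r
    · intro v hv h
      simp only [hstep _ v hv]
      exact hN _ h _ (hS v)
  · intro S g h0 h1
    refine hind (P := fun v => R (depth v) S v = g v) ((hroot S).trans h0) fun v hv h => ?_
    rw [hstep S v hv, h1 v hv, ← h]

/-! ### Families of triangles and the image of `λ` -/

namespace HalfEdgeGraph

variable {n : ℕ} {V : Type*} {Γ : HalfEdgeGraph n V}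

theorem Antisymm.eq_neg {z : V → Γ.Edge → E3} (hz : Γ.Antisymm z) {v w : V} (hvw : v ≠ w)
    {a : Γ.EInt} (hv : v ∈ a.1) (hw : w ∈ a.1) : z w (Sum.inl a) = - z v (Sum.inl a) := by
  obtain ⟨a, ha⟩ := a
  obtain rfl := (Sym2.mem_and_mem_iff hvw).1 ⟨hv, hw⟩
  exact hz v w ha

theorem antisymm_of_oriented {z : V → Γ.Edge → E3} {r : V} {par : V → V}
    (hadj : ∀ v w, Γ.graph.Adj v w → (w ≠ r ∧ par w = v) ∨ (v ≠ r ∧ par v = w))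
    (h : ∀ w, w ≠ r → ∀ a : Γ.EInt, par w ∈ a.1 → w ∈ a.1 → par w ≠ w →
      z w (Sum.inl a) = - z (par w) (Sum.inl a)) : Γ.Antisymm z := by
  intro v w hvw
  rcases hadj v w hvw with ⟨h1, rfl⟩ | ⟨h1, rfl⟩
  · exact h w h1 _ (Sym2.mem_mk_left _ _) (Sym2.mem_mk_right _ _) hvw.ne
  · rw [eq_comm, neg_eq_iff_eq_neg]
    exact h v h1 _ (Sym2.mem_mk_right _ _) (Sym2.mem_mk_left _ _) hvw.ne.symm

theorem balanced_of_triple {v : V} {z : Γ.Edge → E3} {a b c : Γ.Edge}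
    (h : ∀ f, Γ.Incident v f ↔ f = a ∨ f = b ∨ f = c) (hz : z a + z b + z c = 0) :
    Balanced v z := by
  intro a' b' c' h1 h2 h3 h'
  rcases (h a').1 ((h' a').2 (by simp)) with rfl | rfl | rfl <;>
  rcases (h b').1 ((h' b').2 (by simp)) with rfl | rfl | rfl <;>
  rcases (h c').1 ((h' c').2 (by simp)) with rfl | rfl | rfl <;>
  first
    | exact absurd rfl h1
    | exact absurd rfl h2
    | exact absurd rfl h3
    | (refine Eq.trans ?_ hz; abel)

/-- Values at three incident edges which sum to zero extend to a balanced function. -/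
theorem exists_balanced {v : V} {a b c : Γ.Edge} (hab : a ≠ b) (hac : a ≠ c) (hbc : b ≠ c)
    (h : ∀ f, Γ.Incident v f ↔ f = a ∨ f = b ∨ f = c) {x y z : E3} (hz : x + y + z = 0) :
    ∃ s : Γ.Edge → E3, Balanced v s ∧ s a = x ∧ s b = y ∧ s c = z := by
  classical
  refine ⟨fun e => if e = a then x else if e = b then y else z, balanced_of_triple h ?_, ?_⟩
  all_goals simp [hab.symm, hac.symm, hbc.symm, hz]

/-- The first side may be prescribed freely: this is exactly what `exists_glue` needs to continue a
solution across an edge. -/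
theorem Admissible.exists_local (hΓ : Γ.Admissible) {D : Γ.Edge → ℝ} (hD : D ∈ Γ.polyhedron)
    {v : V} {e : Γ.Edge} (he : Γ.Incident v e) {u : E3} (hu : ‖u‖ = D e) :
    ∃ z, (Balanced v z ∧ ∀ e, Γ.Incident v e → ‖z e‖ = D e) ∧ z e = u := by
  obtain ⟨b, c, h1, h2, h3, h⟩ := hΓ.exists_triple v he
  have hI := fun f => (h f).2
  obtain ⟨h4, h5⟩ := hD.2 v e b c he (hI b (by simp)) (hI c (by simp)) h1 h3 h2
  rw [← hu] at h4 h5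
  obtain ⟨y, hy, hy'⟩ := exists_triangle u (hD.1 b) h4 h5
  obtain ⟨z, hz, za, zb, zc⟩ := exists_balanced h1 h2 h3 h (add_neg_cancel (u + y))
  refine ⟨z, ⟨hz, fun f hf => ?_⟩, za⟩
  rcases (h f).1 hf with rfl | rfl | rfl
  · rw [za, hu]
  · rw [zb, hy]
  · rw [zc, norm_neg, hy']

/-- Every point of the polyhedron is realized by a closed polygon. -/
theorem Admissible.exists_polygon [Finite V] (hΓ : Γ.Admissible) {D : Γ.Edge → ℝ}
    (hD : D ∈ Γ.polyhedron) :
    ∃ x : Fin n → E3, ∑ i, x i = 0 ∧ ∀ v e, Γ.Incident v e → ‖Γ.flag x v e‖ = D e := by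
  obtain ⟨z, hz, hanti⟩ := hΓ.exists_glue
    (fun v z => Balanced v z ∧ ∀ e, Γ.Incident v e → ‖z e‖ = D e) (fun v => by
      obtain ⟨e, he⟩ := hΓ.exists_incident v
      obtain ⟨u, hu⟩ := exists_norm_eq E3 (hD.1 e)
      obtain ⟨z, hz, -⟩ := hΓ.exists_local hD he hu
      exact ⟨z, hz⟩) (fun v w h z hz => by
      refine hΓ.exists_local hD (show Γ.Incident w (Sum.inl ⟨s(v, w), h⟩) from Sym2.mem_mk_right v w) ?_
      rw [norm_neg]
      exact hz.2 _ (show Γ.Incident v (Sum.inl ⟨s(v, w), h⟩) from Sym2.mem_mk_left v w))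
  refine ⟨Γ.tips z, hΓ.sum_tips (fun v => (hz v).1) hanti, fun v e he => ?_⟩
  rw [hΓ.flag_tips (fun v => (hz v).1) hanti he]
  exact (hz v).2 e he

/-- Setting all lengths to `1` satisfies the triangle inequalities, so some polygon has unit flag
vectors everywhere; a sum over an empty branch would vanish. -/
theorem Admissible.branch_nonempty [Finite V] (hΓ : Γ.Admissible) {v : V} {e : Γ.Edge}
    (he : Γ.Incident v e) : (Γ.branch v e).Nonempty := by
  obtain ⟨x, -, hx⟩ := hΓ.exists_polygon (D := fun _ => 1)
    ⟨fun _ => zero_le_one, fun v a b c _ _ _ _ _ _ => by norm_num⟩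
  by_contra h
  have := hx v e he
  rw [Set.not_nonempty_iff_eq_empty] at h
  simp [flag, h] at this

theorem exists_incident_vertex [Nonempty V] (e : Γ.Edge) : ∃ v, Γ.Incident v e := by
  rcases e with ⟨a, ha⟩ | i
  · induction a with
    | h p q => exact ⟨p, Sym2.mem_mk_left p q⟩
  · exact ⟨_, rfl⟩

theorem Admissible.lengths_mk (hΓ : Γ.Admissible) (o : Γ.Orientation) {ℓ : Fin n → ℝ}
    (x : closedPolygons ℓ) (a : Γ.EInt) :
    o.lengths ℓ (ModuliSpace.mk x) a = ‖Γ.flag x.1 (o.dart a).snd (Sum.inl a)‖ := by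
  classical
  change ‖∑ i ∈ Finset.univ.filter (fun i => i ∈ o.side a), x.1 i‖ = _
  rw [Finset.sum_filter, flag, hΓ.side_eq]

theorem Orientation.incident_snd (o : Γ.Orientation) (a : Γ.EInt) :
    Γ.Incident (o.dart a).snd (Sum.inl a) := by
  change (o.dart a).snd ∈ a.1
  rw [← o.edge_dart a]
  exact Sym2.mem_mk_right _ _

theorem Admissible.norm_flag (hΓ : Γ.Admissible) (o : Γ.Orientation) {ℓ : Fin n → ℝ}
    (x : closedPolygons ℓ) {v : V} {e : Γ.Edge} (he : Γ.Incident v e) :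
    ‖Γ.flag x.1 v e‖ = Sum.elim (o.lengths ℓ (ModuliSpace.mk x)) ℓ e := by
  rcases e with a | i
  · rw [Sum.elim_inl, hΓ.lengths_mk]
    by_cases h : v = (o.dart a).snd
    · rw [h]
    · rw [(hΓ.antisymm_flag x.2.2).eq_neg (Ne.symm h) (o.incident_snd a) he, norm_neg]
  · rw [flag_inr, Sum.elim_inr]
    exact x.2.1 i

theorem Admissible.lengths_mem (hΓ : Γ.Admissible) (o : Γ.Orientation) {ℓ : Fin n → ℝ}
    (x : closedPolygons ℓ) : o.lengths ℓ (ModuliSpace.mk x) ∈ Γ.slicedPolyhedron ℓ := by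
  have := hΓ.connected.nonempty
  refine ⟨fun e => ?_, fun v a b c ha hb hc hab hbc hac => ?_⟩
  · obtain ⟨v, hv⟩ := exists_incident_vertex e
    rw [← hΓ.norm_flag o x hv]
    exact norm_nonneg _
  · rw [← hΓ.norm_flag o x ha, ← hΓ.norm_flag o x hb, ← hΓ.norm_flag o x hc]
    exact triangle_of_sum_eq_zero (hΓ.balanced_flag x.2.2 v a b c hab hac hbc
      (hΓ.incident_iff ha hb hc hab hbc hac))

theorem Admissible.exists_lengths_eq [Finite V] (hΓ : Γ.Admissible) (o : Γ.Orientation)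
    {ℓ : Fin n → ℝ} {d : Γ.EInt → ℝ} (hd : d ∈ Γ.slicedPolyhedron ℓ) :
    ∃ x : closedPolygons ℓ, o.lengths ℓ (ModuliSpace.mk x) = d := by
  obtain ⟨x, hx, hn⟩ := hΓ.exists_polygon hd
  refine ⟨⟨x, fun i => ?_, hx⟩, funext fun a => ?_⟩
  · have := hn (Γ.endpoint i) (Sum.inr i) rfl
    rwa [flag_inr] at this
  · rw [hΓ.lengths_mk]
    exact hn _ _ (o.incident_snd a)

theorem mk_surjective {ℓ : Fin n → ℝ} :
    Function.Surjective (ModuliSpace.mk : closedPolygons ℓ → ModuliSpace ℓ) :=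
  Quotient.mk_surjective

theorem continuous_mk {ℓ : Fin n → ℝ} :
    Continuous (ModuliSpace.mk : closedPolygons ℓ → ModuliSpace ℓ) :=
  continuous_quotient_mk'

theorem Admissible.range_lengths [Finite V] (hΓ : Γ.Admissible) (o : Γ.Orientation)
    (ℓ : Fin n → ℝ) : Set.range (o.lengths ℓ) = Γ.slicedPolyhedron ℓ := by
  ext d
  constructor
  · rintro ⟨p, rfl⟩
    obtain ⟨x, rfl⟩ := mk_surjective p
    exact hΓ.lengths_mem o x
  · intro hd
    obtain ⟨x, hx⟩ := hΓ.exists_lengths_eq o hd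
    exact ⟨_, hx⟩

/-! ### Connectedness of the fibres -/

/-- Polygons with the same lengths are conjugate vertex by vertex. -/
theorem Admissible.exists_ad_flag (hΓ : Γ.Admissible) (o : Γ.Orientation) {ℓ : Fin n → ℝ}
    {x y : closedPolygons ℓ}
    (h : o.lengths ℓ (ModuliSpace.mk x) = o.lengths ℓ (ModuliSpace.mk y)) (v : V) :
    ∃ g ∈ SU2, ∀ e, Γ.Incident v e → ad g (Γ.flag x.1 v e) = Γ.flag y.1 v e := by
  obtain ⟨a, ha⟩ := hΓ.exists_incident v
  obtain ⟨b, c, h1, h2, h3, hI⟩ := hΓ.exists_triple v ha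
  have hn : ∀ e, Γ.Incident v e → ‖Γ.flag x.1 v e‖ = ‖Γ.flag y.1 v e‖ := fun e he => by
    rw [hΓ.norm_flag o x he, hΓ.norm_flag o y he, h]
  obtain ⟨g, hg, ga, gb, gc⟩ := exists_ad_triple
    (hΓ.balanced_flag x.2.2 v a b c h1 h2 h3 hI) (hΓ.balanced_flag y.2.2 v a b c h1 h2 h3 hI)
    (hn a ha) (hn b ((hI b).2 (by simp))) (hn c ((hI c).2 (by simp)))
  refine ⟨g, hg, fun e he => ?_⟩
  rcases (hI e).1 he with rfl | rfl | rfl <;> assumption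

/-- Starting from `x`, rotate the triangle at each `v` by the product of elements `S` along the path
from the root. The triangles still fit together when each `S v` fixes the edge from `v` to its
parent, and every polygon with the same lengths arises so. -/
theorem Admissible.isPreconnected_polygons [Finite V] (hΓ : Γ.Admissible) (o : Γ.Orientation)
    {ℓ : Fin n → ℝ} (x : closedPolygons ℓ) :
    IsPreconnected {y : closedPolygons ℓ |
      o.lengths ℓ (ModuliSpace.mk y) = o.lengths ℓ (ModuliSpace.mk x)} := by
  classical
  obtain ⟨r, par, R, hpar, hadj, hcont, hstep, hmem, huniq⟩ :=
    exists_path_product (M := M2) hΓ.connected hΓ.acyclic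
  -- The axis is the flag vector towards the parent. At the root it is `0`, whose stabilizer is all
  -- of `SU(2)`.
  have hax : ∀ v, ∃ u : E3, (v = r → u = 0) ∧
      ∀ a : Γ.EInt, v ≠ r → par v ∈ a.1 → v ∈ a.1 → u = Γ.flag x.1 v (Sum.inl a) := by
    intro v
    by_cases hv : v = r
    · exact ⟨0, fun _ => rfl, fun _ h => (h hv).elim⟩
    · refine ⟨Γ.flag x.1 v (Sum.inl ⟨s(par v, v), hpar v hv⟩), fun h => (hv h).elim, ?_⟩
      rintro ⟨a, ha⟩ - h1 h2
      obtain rfl := (Sym2.mem_and_mem_iff (hpar v hv).ne).1 ⟨h1, h2⟩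
      rfl
  choose axis hroot haxis using hax
  have hx0 := hΓ.antisymm_flag x.2.2
  rw [← Topology.IsInducing.subtypeVal.isPreconnected_image]
  have hpre := (isPreconnected_univ_pi fun v => isPreconnected_stab (axis v)).image
    (fun S (i : Fin n) => ad (R S (Γ.endpoint i)) (x.1 i))
    (continuous_pi fun i => (continuous_ad _).comp (hcont _)).continuousOn
  convert hpre using 1
  ext y
  constructor
  · rintro ⟨y, hy, rfl⟩
    have hy0 := hΓ.antisymm_flag y.2.2
    choose g hg hgy using hΓ.exists_ad_flag o (Eq.symm hy)
    -- The relative rotation `(g (par v))⁻¹ * g v` fixes the shared edge, because both factors carry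
    -- it to the same edge of `y`.
    have hS : ∀ v, ∃ S ∈ stab (axis v), (v = r → S = g v) ∧ (v ≠ r → g v = g (par v) * S) := by
      intro v
      by_cases hv : v = r
      · refine ⟨g v, ⟨hg v, ?_⟩, fun _ => rfl, fun h => (h hv).elim⟩
        rw [hroot v hv, ad_zero (hg v)]
      · have hav := hpar v hv
        have h1 : Γ.Incident (par v) (Sum.inl ⟨s(par v, v), hav⟩) := Sym2.mem_mk_left _ _
        have h2 : Γ.Incident v (Sum.inl ⟨s(par v, v), hav⟩) := Sym2.mem_mk_right _ _
        have hp := SU2.star_mem (hg (par v))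
        refine ⟨star (g (par v)) * g v, ⟨SU2.mul_mem hp (hg v), ?_⟩, fun h => (hv h).elim,
          fun _ => ?_⟩
        · rw [haxis v ⟨s(par v, v), hav⟩ hv h1 h2, ad_mul _ (hg v), hgy v _ h2, hy0 _ _ hav,
            ad_neg hp, ← hgy _ _ h1, ad_star_ad (hg _), hx0 _ _ hav]
        · rw [← mul_assoc, SU2.mul_star (hg _), one_mul]
    choose S hSs hSr hSp using hS
    refine ⟨S, fun v _ => hSs v, funext fun i => ?_⟩
    have := hgy (Γ.endpoint i) (Sum.inr i) rfl
    rw [flag_inr, flag_inr] at this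
    change ad (R S (Γ.endpoint i)) (x.1 i) = y.1 i
    rw [huniq S g (hSr r rfl) hSp, this]
  · rintro ⟨S, hS, rfl⟩
    have hS' : ∀ v, S v ∈ stab (axis v) := fun v => hS v trivial
    have hR : ∀ v, R S v ∈ SU2 := hmem SU2 S (fun _ ha _ hb => SU2.mul_mem ha hb)
      fun v => (hS' v).1
    set z : V → Γ.Edge → E3 := fun v e => ad (R S v) (Γ.flag x.1 v e) with hz
    have hb : ∀ v, Balanced v (z v) := by
      intro v a b c h1 h2 h3 h
      rw [hz]
      simp only
      rw [← ad_add (hR v), ← ad_add (hR v), hΓ.balanced_flag x.2.2 v a b c h1 h2 h3 h,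
        ad_zero (hR v)]
    have hanti : Γ.Antisymm z := by
      refine antisymm_of_oriented hadj fun w hw a h1 h2 hne => ?_
      have hs := (hS' w).2
      rw [haxis w a hw h1 h2] at hs
      simp only [hz]
      rw [hstep S w hw, ad_mul _ (hS' w).1, hs, hx0.eq_neg hne h1 h2, ad_neg (hR _)]
    have htips : Γ.tips z = fun i => ad (R S (Γ.endpoint i)) (x.1 i) := by
      funext i
      simp [tips, hz]
    have hflag : ∀ v e, Γ.Incident v e → Γ.flag (Γ.tips z) v e = z v e := fun v e he =>
      hΓ.flag_tips hb hanti he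
    have hsum := hΓ.sum_tips hb hanti
    rw [htips] at hflag hsum
    refine ⟨⟨_, fun i => ?_, hsum⟩, funext fun a => ?_, rfl⟩
    · rw [norm_ad (hR _)]
      exact x.2.1 i
    · rw [hΓ.lengths_mk, hΓ.lengths_mk, hflag _ _ (o.incident_snd a)]
      exact norm_ad (hR _) _

theorem Admissible.isConnected_fibre [Finite V] (hΓ : Γ.Admissible) (o : Γ.Orientation)
    {ℓ : Fin n → ℝ} {d : Γ.EInt → ℝ} (hd : d ∈ Γ.slicedPolyhedron ℓ) :
    IsConnected (o.lengths ℓ ⁻¹' {d}) := by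
  obtain ⟨x, rfl⟩ := hΓ.exists_lengths_eq o hd
  refine ⟨⟨_, rfl⟩, ?_⟩
  convert (hΓ.isPreconnected_polygons o x).image _ continuous_mk.continuousOn using 1
  ext p
  constructor
  · intro hp
    obtain ⟨y, rfl⟩ := mk_surjective p
    exact ⟨y, hp, rfl⟩
  · rintro ⟨y, hy, rfl⟩
    exact hy

end HalfEdgeGraph

/-! ### Deformations of polygons -/

theorem norm_sq_orthogonal_add {s c m : E3} (hsc : ⟪s, c⟫ = 0) (hms : ⟪m, s⟫ = 0)
    (hmc : ⟪m, c⟫ = 0) (hmn : ‖m‖ = ‖c‖) (q θ : ℝ) :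
    ‖q • s + (Real.cos θ • c + Real.sin θ • m)‖ ^ 2 = q ^ 2 * ‖s‖ ^ 2 + ‖c‖ ^ 2 := by
  have h := Real.sin_sq_add_cos_sq θ
  rw [norm_add_sq_real, norm_add_sq_real, norm_smul, norm_smul, norm_smul, hmn]
  simp only [inner_add_right, inner_smul_left, inner_smul_right, hsc, real_inner_comm m s,
    real_inner_comm m c, hms, hmc, mul_pow, Real.norm_eq_abs, sq_abs]
  linear_combination ‖c‖ ^ 2 * h

/-- Rotating two edges of a polygon around their sum. -/
theorem exists_bend {n : ℕ} {ℓ : Fin n → ℝ} (x : closedPolygons ℓ) {U : Set (closedPolygons ℓ)}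
    (hU : U ∈ 𝓝 x) {i j : Fin n} (hij : i ≠ j) (hg : gram (x.1 i) (x.1 j) ≠ 0) {w : E3}
    (hw : w ≠ 0) :
    ∃ y ∈ U, ∃ δ : E3, gram w δ ≠ 0 ∧ y.1 = x.1 + Pi.single i δ - Pi.single j δ := by
  set s := x.1 i + x.1 j with hs
  have hs0 : s ≠ 0 := by
    intro h
    have h1 : x.1 j = (-1 : ℝ) • x.1 i := by
      rw [neg_one_smul]; exact (neg_eq_of_add_eq_zero_right h).symm
    apply hg
    rw [h1]
    conv_lhs => rw [← one_smul ℝ (x.1 i)]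
    rw [smul_smul]
    exact gram_smul_smul _ _ _
  have hsn : ‖s‖ ^ 2 ≠ 0 := by simpa using hs0
  -- The sides are `p • s + c` and `(1 - p) • s - c` with `c` orthogonal to `s`; `c` is nonzero as
  -- the sides are not parallel.
  set p : ℝ := ⟪s, x.1 i⟫ / ‖s‖ ^ 2 with hp
  set c := x.1 i - p • s with hc
  have hxi : x.1 i = p • s + c := by rw [hc]; abel
  have hxj : x.1 j = (1 - p) • s - c := by
    rw [hc, sub_smul, one_smul, hs]; abel
  have hsc : ⟪s, c⟫ = 0 := by
    rw [hc, inner_sub_right, inner_smul_right, real_inner_self_eq_norm_sq, hp,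
      div_mul_cancel₀ _ hsn, sub_self]
  have hc0 : c ≠ 0 := by
    intro h
    apply hg
    rw [hxi, hxj, h, add_zero, sub_zero]
    exact gram_smul_smul _ _ _
  have hcn : ‖c‖ ≠ 0 := norm_ne_zero_iff.2 hc0
  obtain ⟨m0, hm0, hm0s, hm0c⟩ := exists_unit_orthogonal s c
  set m := ‖c‖ • m0 with hm
  have hms : ⟪m, s⟫ = 0 := by rw [hm, real_inner_smul_left, hm0s, mul_zero]
  have hmc : ⟪m, c⟫ = 0 := by rw [hm, real_inner_smul_left, hm0c, mul_zero]
  have hmn : ‖m‖ = ‖c‖ := by rw [hm, norm_smul, hm0, mul_one, norm_norm]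
  have hm1 : m ≠ 0 := by rw [← norm_ne_zero_iff, hmn]; exact hcn
  -- `δ θ` is the displacement of `x i` under the rotation by `θ` about `s`, with `m` the quarter
  -- turn of `c`; `x j` moves by the opposite amount.
  let δ : ℝ → E3 := fun θ => (Real.cos θ - 1) • c + Real.sin θ • m
  have hnorm := norm_sq_orthogonal_add hsc hms hmc hmn
  have hn0 : ∀ q : ℝ, ‖q • s + c‖ ^ 2 = q ^ 2 * ‖s‖ ^ 2 + ‖c‖ ^ 2 := fun q => by
    have := hnorm q 0
    rwa [Real.cos_zero, Real.sin_zero, one_smul, zero_smul, add_zero] at this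
  have hδi : ∀ θ, ‖x.1 i + δ θ‖ = ‖x.1 i‖ := fun θ => by
    rw [← sq_eq_sq₀ (norm_nonneg _) (norm_nonneg _), hxi, hn0, ← hnorm p θ]
    simp only [δ]
    congr 2
    module
  have hδj : ∀ θ, ‖x.1 j - δ θ‖ = ‖x.1 j‖ := fun θ => by
    rw [← sq_eq_sq₀ (norm_nonneg _) (norm_nonneg _), hxj, ← norm_neg ((1 - p) • s - c),
      show -((1 - p) • s - c) = (p - 1) • s + c by module, hn0, ← hnorm (p - 1) θ, ← norm_neg]
    simp only [δ]
    congr 2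
    module
  let γ : ℝ → closedPolygons ℓ := fun θ => ⟨x.1 + Pi.single i (δ θ) - Pi.single j (δ θ), by
    refine ⟨fun k => ?_, ?_⟩
    · rw [← x.2.1 k]
      by_cases hki : k = i
      · subst hki
        simp [hij, hδi]
      · by_cases hkj : k = j
        · subst hkj
          simp [hij.symm, hδj]
        · simp [hki, hkj]
    · simp only [Pi.sub_apply, Pi.add_apply, Finset.sum_sub_distrib, Finset.sum_add_distrib,
        Finset.sum_pi_single', Finset.mem_univ, if_true, x.2.2, zero_add, sub_self]⟩
  have hδc : Continuous δ := by fun_prop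
  have hγc : Continuous γ := by
    refine Continuous.subtype_mk ?_ _
    refine continuous_pi fun k => ?_
    simp only [Pi.sub_apply, Pi.add_apply, Pi.single_apply]
    refine (continuous_const.add ?_).sub ?_
    · split_ifs
      exacts [hδc, continuous_const]
    · split_ifs
      exacts [hδc, continuous_const]
  have hγ0 : γ 0 = x := by
    apply Subtype.ext
    simp [γ, δ]
  have h1 : ∀ᶠ θ in 𝓝 (0 : ℝ), γ θ ∈ U := hγc.continuousAt.eventually (by rwa [hγ0])
  have h2 : ∀ᶠ θ in 𝓝 (0 : ℝ), γ (-θ) ∈ U :=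
    (hγc.comp continuous_neg).continuousAt.eventually (by simpa [hγ0] using hU)
  obtain ⟨θ, ⟨hθ1, hθ2⟩, hθ3⟩ := (((h1.and h2).filter_mono nhdsWithin_le_nhds).and
    (Ioo_mem_nhdsGT Real.pi_pos)).exists
  by_cases hd1 : gram w (δ θ) = 0
  swap
  · exact ⟨γ θ, hθ1, δ θ, hd1, rfl⟩
  by_cases hd2 : gram w (δ (-θ)) = 0
  swap
  · exact ⟨γ (-θ), hθ2, δ (-θ), hd2, rfl⟩
  -- If the displacements for `θ` and `-θ` were both parallel to `w`, their difference and sum would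
  -- make the orthogonal nonzero vectors `m` and `c` parallel to `w`.
  exfalso
  obtain ⟨r1, hr1⟩ := exists_smul_of_gram_eq_zero hw hd1
  obtain ⟨r2, hr2⟩ := exists_smul_of_gram_eq_zero hw hd2
  simp only [δ, Real.cos_neg, Real.sin_neg] at hr1 hr2
  have hsin : 0 < Real.sin θ := Real.sin_pos_of_pos_of_lt_pi hθ3.1 hθ3.2
  have hcos : Real.cos θ - 1 ≠ 0 := by
    have := Real.sin_sq_add_cos_sq θ
    intro h
    have h' : Real.cos θ = 1 := by linarith
    rw [h'] at this
    nlinarith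
  have e1 : (2 * Real.sin θ) • m = (r1 - r2) • w := by
    rw [sub_smul, ← hr1, ← hr2]; module
  have e2 : (2 * (Real.cos θ - 1)) • c = (r1 + r2) • w := by
    rw [add_smul, ← hr1, ← hr2]; module
  have e3 : (r1 - r2) * ((r1 + r2) * ‖w‖ ^ 2) = 0 := by
    rw [← real_inner_self_eq_norm_sq, ← inner_smul_right, ← real_inner_smul_left, ← e1, ← e2,
      real_inner_smul_left, inner_smul_right, hmc, mul_zero, mul_zero]
  have hwn : ‖w‖ ^ 2 ≠ 0 := by simpa using hw
  have e4 : r1 - r2 ≠ 0 := by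
    intro h
    rw [h, zero_smul, smul_eq_zero] at e1
    rcases e1 with h' | h'
    · linarith
    · exact hm1 h'
  have e5 : r1 + r2 ≠ 0 := by
    intro h
    rw [h, zero_smul, smul_eq_zero] at e2
    rcases e2 with h' | h'
    · exact hcos (by linarith)
    · exact hc0 h'
  exact mul_ne_zero e4 (mul_ne_zero e5 hwn) e3

/-- Two parallel edges which point in the same direction can be buckled. -/
theorem exists_buckle {A B : ℝ} (hA : 0 < A) (hB : 0 < B) {u : E3} (hu : ‖u‖ = 1) {ε : ℝ}
    (hε : 0 < ε) : ∃ δ₀ > 0, ∀ δ, 0 < δ → δ < δ₀ → ∃ y z : E3, ‖y‖ = A ∧ ‖z‖ = B ∧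
      y + z = (A + B - δ) • u ∧ gram y z ≠ 0 ∧ ‖y - A • u‖ < ε ∧ ‖z - B • u‖ < ε := by
  -- `δ < A` and `δ < B` make the triangle with sides `A`, `B`, `A + B - δ` nondegenerate. The other
  -- bounds control the displacements, whose squares are `A δ (2 B - δ) / T` and `B δ (2 A - δ) /
  -- T`.
  refine ⟨min (min A B) (min (ε ^ 2 / (2 * A)) (ε ^ 2 / (2 * B))), by positivity,
    fun δ hδ hlt => ?_⟩
  obtain ⟨⟨h1, h2⟩, h3, h4⟩ : (δ < A ∧ δ < B) ∧ δ < ε ^ 2 / (2 * A) ∧ δ < ε ^ 2 / (2 * B) := by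
    simpa [lt_min_iff] using hlt
  rw [lt_div_iff₀ (by positivity)] at h3 h4
  set T := A + B - δ with hT
  have hT0 : 0 < T := by linarith
  have huT : ‖(-T) • u‖ = T := by
    rw [norm_smul, hu, mul_one, Real.norm_eq_abs, abs_neg, abs_of_pos hT0]
  obtain ⟨y, hy, hy'⟩ := exists_triangle ((-T) • u) (β := A) (γ := B) hA.le
    (by rw [huT, abs_le]; constructor <;> linarith) (by rw [huT]; linarith)
  have hz : ‖T • u - y‖ = B := by
    rw [← hy', ← norm_neg]; congr 1; module
  have hin : B ^ 2 = T ^ 2 - 2 * (T * ⟪u, y⟫) + A ^ 2 := by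
    rw [← hz, norm_sub_sq_real, norm_smul, hu, hy, real_inner_smul_left, mul_one, Real.norm_eq_abs,
      sq_abs]
  have hsum : y + (T • u - y) + (-T) • u = 0 := by module
  refine ⟨y, T • u - y, hy, hz, by abel, ?_, ?_, ?_⟩
  · rw [gram_ne_zero_iff hsum, hy, hz, huT, abs_lt]
    refine ⟨⟨?_, ?_⟩, ?_⟩ <;> linarith
  · refine lt_of_pow_lt_pow_left₀ 2 hε.le ?_
    have : ‖y - A • u‖ ^ 2 = 2 * A ^ 2 - 2 * A * ⟪u, y⟫ := by
      rw [norm_sub_sq_real, norm_smul, hu, hy, inner_smul_right, real_inner_comm, Real.norm_eq_abs,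
        mul_one, sq_abs]
      ring
    rw [this]
    have e : T * (2 * A ^ 2 - 2 * A * ⟪u, y⟫) = A * (δ * (2 * B - δ)) := by
      rw [show T = A + B - δ from hT] at hin ⊢
      linear_combination (-A) * hin
    have h5 : A * (δ * (2 * B - δ)) < T * ε ^ 2 := by
      have : δ * (2 * B - δ) < ε ^ 2 := by nlinarith
      nlinarith [sq_nonneg ε]
    rw [← e] at h5
    exact lt_of_mul_lt_mul_left h5 hT0.le
  · refine lt_of_pow_lt_pow_left₀ 2 hε.le ?_
    have : ‖T • u - y - B • u‖ ^ 2 = 2 * B ^ 2 - 2 * B * (T - ⟪u, y⟫) := by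
      rw [norm_sub_sq_real, norm_smul, hu, hz, inner_smul_right, inner_sub_left,
        real_inner_smul_left, real_inner_self_eq_norm_sq, hu, real_inner_comm, Real.norm_eq_abs,
        mul_one, sq_abs]
      ring
    rw [this]
    have e : T * (2 * B ^ 2 - 2 * B * (T - ⟪u, y⟫)) = B * (δ * (2 * A - δ)) := by
      rw [show T = A + B - δ from hT] at hin ⊢
      linear_combination B * hin
    have h5 : B * (δ * (2 * A - δ)) < T * ε ^ 2 := by
      have : δ * (2 * A - δ) < ε ^ 2 := by nlinarith
      nlinarith [sq_nonneg ε]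
    rw [← e] at h5
    exact lt_of_mul_lt_mul_left h5 hT0.le

/-- A single positive coefficient would balance all the others and so equal half of the total,
against the strict inequality. -/
theorem exists_two_pos {n : ℕ} (hn : 0 < n) {c : Fin n → ℝ} (h0 : ∀ i, c i ≠ 0)
    (hsum : ∑ i, c i = 0) (hc : ∀ j, |c j| < 1 / 2 * ∑ i, |c i|) :
    ∃ i k, i ≠ k ∧ 0 < c i ∧ 0 < c k := by
  obtain ⟨i, -, hi⟩ := Finset.exists_pos_of_sum_zero_of_exists_nonzero c hsum
    ⟨⟨0, hn⟩, Finset.mem_univ _, h0 _⟩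
  by_contra! h
  have h1 : ∑ k, (|c k| + c k) = |c i| + c i := by
    refine Finset.sum_eq_single i (fun k _ hk => ?_) fun h' => (h' (Finset.mem_univ _)).elim
    rw [abs_of_nonpos (h i k (Ne.symm hk) hi), neg_add_cancel]
  rw [Finset.sum_add_distrib, hsum, add_zero] at h1
  have h2 := hc i
  rw [h1, abs_of_pos hi] at h2
  linarith

/-- The polygons which do not belong to a line are dense. -/
theorem exists_noncollinear {n : ℕ} (hn : 0 < n) {ℓ : Fin n → ℝ} (hpos : ∀ i, 0 < ℓ i)
    (hpoly : ∀ j, ℓ j < 1 / 2 * ∑ i, ℓ i) (x : closedPolygons ℓ) {U : Set (closedPolygons ℓ)}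
    (hU : U ∈ 𝓝 x) : ∃ y ∈ U, ∃ i j, gram (y.1 i) (y.1 j) ≠ 0 := by
  by_cases hx : ∃ i j, gram (x.1 i) (x.1 j) ≠ 0
  · exact ⟨x, mem_of_mem_nhds hU, hx⟩
  push Not at hx
  obtain ⟨u, hu, hxu⟩ := exists_unit_smul (x.1 ⟨0, hn⟩)
  have hx0 : x.1 ⟨0, hn⟩ ≠ 0 := by
    rw [← norm_ne_zero_iff, x.2.1]; exact (hpos _).ne'
  have hcu : ∀ i, ∃ c : ℝ, x.1 i = c • u := fun i => by
    obtain ⟨r, hr⟩ := exists_smul_of_gram_eq_zero hx0 (hx ⟨0, hn⟩ i)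
    exact ⟨r * ‖x.1 ⟨0, hn⟩‖, by rw [hr, mul_smul, ← hxu]⟩
  choose c hc using hcu
  have hu0 : u ≠ 0 := by rintro rfl; simp at hu
  have hcl : ∀ i, |c i| = ℓ i := fun i => by
    rw [← x.2.1 i, hc, norm_smul, hu, mul_one, Real.norm_eq_abs]
  have hc0 : ∀ i, c i ≠ 0 := fun i h => by
    have := hcl i
    rw [h, abs_zero] at this
    exact (hpos i).ne this
  have hcs : ∑ i, c i = 0 := by
    have := x.2.2
    simp only [hc, ← Finset.sum_smul] at this
    exact (smul_eq_zero.1 this).resolve_right hu0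
  obtain ⟨i, k, hik, hi, hk⟩ := exists_two_pos hn hc0 hcs (by simpa [hcl] using hpoly)
  obtain ⟨j, m, hjm, hj, hm⟩ := exists_two_pos hn (c := fun i => - c i)
    (fun i => neg_ne_zero.2 (hc0 i)) (by rw [Finset.sum_neg_distrib, hcs, neg_zero])
    (by simpa [hcl] using hpoly)
  have hij : i ≠ j := by rintro rfl; linarith
  have him : i ≠ m := by rintro rfl; linarith
  have hkj : k ≠ j := by rintro rfl; linarith
  have hkm : k ≠ m := by rintro rfl; linarith
  obtain ⟨W, hW, hWU⟩ := mem_nhds_induced _ _ _ |>.1 hU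
  obtain ⟨ε, hε, hεW⟩ := Metric.mem_nhds_iff.1 hW
  -- Two sides pointing along `u` and two pointing along `-u` are buckled with a common shortening
  -- `δ`, so the polygon stays closed.
  obtain ⟨δ₁, hδ₁, H₁⟩ := exists_buckle hi hk hu hε
  obtain ⟨δ₂, hδ₂, H₂⟩ := exists_buckle hj hm (u := -u) (by rwa [norm_neg]) hε
  obtain ⟨δ, hδ0, hδ⟩ := exists_between (lt_min hδ₁ hδ₂)
  obtain ⟨y1, y2, n1, n2, s12, g12, e1, e2⟩ := H₁ δ hδ0 (hδ.trans_le (min_le_left _ _))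
  obtain ⟨y3, y4, n3, n4, s34, -, e3, e4⟩ := H₂ δ hδ0 (hδ.trans_le (min_le_right _ _))
  set y : Fin n → E3 := x.1 + (Pi.single i (y1 - x.1 i) + Pi.single k (y2 - x.1 k) +
    Pi.single j (y3 - x.1 j) + Pi.single m (y4 - x.1 m)) with hy
  have hyi : y i = y1 := by simp [hy, hik, hij, him]
  have hyk : y k = y2 := by simp [hy, hik.symm, hkj, hkm]
  have hyj : y j = y3 := by simp [hy, hij.symm, hkj.symm, hjm]
  have hym : y m = y4 := by simp [hy, him.symm, hkm.symm, hjm.symm]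
  have hyt : ∀ t, t ≠ i → t ≠ k → t ≠ j → t ≠ m → y t = x.1 t := fun t h1 h2 h3 h4 => by
    simp [hy, h1, h2, h3, h4]
  have hall : ∀ {P : Fin n → Prop}, P i → P k → P j → P m →
      (∀ t, t ≠ i → t ≠ k → t ≠ j → t ≠ m → P t) → ∀ t, P t := by
    intro P h1 h2 h3 h4 h5 t
    by_cases e1 : t = i
    · exact e1 ▸ h1
    by_cases e2 : t = k
    · exact e2 ▸ h2
    by_cases e3 : t = j
    · exact e3 ▸ h3
    by_cases e4 : t = m
    · exact e4 ▸ h4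
    exact h5 t e1 e2 e3 e4
  have hymem : y ∈ closedPolygons ℓ := by
    refine ⟨hall ?_ ?_ ?_ ?_ fun t h1 h2 h3 h4 => ?_, ?_⟩
    · rw [hyi, n1, ← hcl, abs_of_pos hi]
    · rw [hyk, n2, ← hcl, abs_of_pos hk]
    · rw [hyj, n3, ← hcl, abs_of_neg (neg_pos.1 hj)]
    · rw [hym, n4, ← hcl, abs_of_neg (neg_pos.1 hm)]
    · rw [hyt t h1 h2 h3 h4, x.2.1]
    · simp only [hy, Pi.add_apply, Finset.sum_add_distrib, Finset.sum_pi_single', Finset.mem_univ,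
        if_true, x.2.2, zero_add]
      rw [hc i, hc k, hc j, hc m, show y1 - c i • u + (y2 - c k • u) + (y3 - c j • u) +
        (y4 - c m • u) = (y1 + y2) + (y3 + y4) - (c i + c k + c j + c m) • u by module, s12, s34]
      module
  refine ⟨⟨y, hymem⟩, hWU (hεW ?_), i, k, ?_⟩
  · rw [Metric.mem_ball, dist_pi_lt_iff hε]
    refine hall ?_ ?_ ?_ ?_ fun t h1 h2 h3 h4 => ?_
    · rw [dist_eq_norm, hc]; simpa only [hyi] using e1
    · rw [dist_eq_norm, hc]; simpa only [hyk] using e2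
    · rw [dist_eq_norm, hc]; simpa only [hyj, neg_smul_neg] using e3
    · rw [dist_eq_norm, hc]; simpa only [hym, neg_smul_neg] using e4
    · simpa only [hyt t h1 h2 h3 h4, dist_self] using hε
  · simpa only [hyi, hyk] using g12

/-! ### Degenerate three-part sums can be perturbed -/

section Parts

variable {n : ℕ}

/-- The sum of the vectors in one part of a partition. -/
def partSum (κ : Fin n → Fin 3) (x : Fin n → E3) (p : Fin 3) : E3 :=
  ∑ i, if κ i = p then x i else 0

theorem partSum_bend (κ : Fin n → Fin 3) (x : Fin n → E3) (i j : Fin n) (δ : E3) (p : Fin 3) :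
    partSum κ (x + Pi.single i δ - Pi.single j δ) p = partSum κ x p +
      (if κ i = p then δ else 0) - if κ j = p then δ else 0 := by
  have h : ∀ k : Fin n, (∑ t, if κ t = p then (Pi.single k δ : Fin n → E3) t else 0) =
      if κ k = p then δ else 0 := fun k => by
    rw [Finset.sum_eq_single k]
    · simp
    · intro t _ ht
      simp [ht]
    · exact fun h => (h (Finset.mem_univ _)).elim
  rw [partSum, partSum, ← h i, ← h j, ← Finset.sum_add_distrib, ← Finset.sum_sub_distrib]
  refine Finset.sum_congr rfl fun t _ => ?_
  split_ifs <;> simp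

theorem sum_partSum (κ : Fin n → Fin 3) (x : Fin n → E3) :
    partSum κ x 0 + partSum κ x 1 + partSum κ x 2 = ∑ i, x i := by
  rw [partSum, partSum, partSum, ← Finset.sum_add_distrib, ← Finset.sum_add_distrib]
  refine Finset.sum_congr rfl fun i _ => ?_
  generalize κ i = k
  fin_cases k <;> simp

theorem gram_partSum_eq_zero {κ : Fin n → Fin 3} {x : Fin n → E3} (hx : ∑ i, x i = 0)
    (h : gram (partSum κ x 0) (partSum κ x 1) = 0) (p q : Fin 3) :
    gram (partSum κ x p) (partSum κ x q) = 0 := by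
  rw [← sum_partSum κ x] at hx
  have h02 := (gram_of_sum_eq_zero hx).trans h
  have h12 := (gram_of_sum_eq_zero (a := partSum κ x 1) (b := partSum κ x 0)
    (c := partSum κ x 2)
    (by rw [← hx]; abel)).trans ((gram_comm _ _).trans h)
  have hself : ∀ a : E3, gram a a = 0 := fun a => by
    simpa using gram_smul_smul 1 1 a
  fin_cases p <;> fin_cases q
  exacts [hself _, h, h02, (gram_comm _ _).trans h, hself _, h12, (gram_comm _ _).trans h02,
    (gram_comm _ _).trans h12, hself _]

theorem isOpen_gram_ne_zero {X : Type*} [TopologicalSpace X] {f g : X → E3} (hf : Continuous f)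
    (hg : Continuous g) : IsOpen {x | gram (f x) (g x) ≠ 0} :=
  isOpen_ne_fun (continuous_gram.comp (hf.prodMk hg)) continuous_const

/-- Suppose the three part sums are parallel throughout an open set. Bending a nonparallel pair of
sides in different parts moves those two sums and fixes the third, which must therefore vanish;
bending a side of the third part against another side then moves this zero sum. -/
theorem dense_gram_partSum (hn : 0 < n) {ℓ : Fin n → ℝ} (hpos : ∀ i, 0 < ℓ i)
    (hpoly : ∀ j, ℓ j < 1 / 2 * ∑ i, ℓ i) {κ : Fin n → Fin 3} (hκ : Function.Surjective κ) :
    Dense {x : closedPolygons ℓ | gram (partSum κ x.1 0) (partSum κ x.1 1) ≠ 0} := by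
  intro x
  rw [mem_closure_iff_nhds]
  intro U' hU'
  obtain ⟨U, hUU', hUo, hxU⟩ := mem_nhds_iff.1 hU'
  by_contra hempty
  have hbad : ∀ y ∈ U, ∀ p q, gram (partSum κ y.1 p) (partSum κ y.1 q) = 0 := fun y hy =>
    gram_partSum_eq_zero y.2.2 <| by
      by_contra h
      exact hempty ⟨y, hUU' hy, h⟩
  have hval : ∀ (y : closedPolygons ℓ) i, y.1 i ≠ 0 := fun y i => by
    rw [← norm_ne_zero_iff, y.2.1]; exact (hpos i).ne'
  obtain ⟨y, hyU, hy⟩ := exists_noncollinear hn hpos hpoly x (hUo.mem_nhds hxU)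
  -- If sides in different parts were always parallel, two sides in one part would both be parallel
  -- to a side in another part, hence to each other.
  have hcross : ∃ i j, κ i ≠ κ j ∧ gram (y.1 i) (y.1 j) ≠ 0 := by
    by_contra! h
    obtain ⟨i, j, hij⟩ := hy
    by_cases hκij : κ i = κ j
    · obtain ⟨k, hk⟩ : ∃ k, κ k ≠ κ i := by
        obtain ⟨q, hq⟩ := exists_ne (κ i)
        obtain ⟨k, rfl⟩ := hκ q
        exact ⟨k, hq⟩
      obtain ⟨r, hr⟩ := exists_smul_of_gram_eq_zero (hval y k) (h k i hk)
      obtain ⟨r', hr'⟩ := exists_smul_of_gram_eq_zero (hval y k) (h k j (hκij ▸ hk))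
      exact hij (by rw [hr, hr']; exact gram_smul_smul _ _ _)
    · exact hij (h i j hκij)
  obtain ⟨i, j, hκij, hij⟩ := hcross
  obtain ⟨s, hsi, hsj⟩ : ∃ s, κ i ≠ s ∧ κ j ≠ s := by
    generalize κ i = p
    generalize κ j = q
    revert p q
    decide
  -- The sum over `s` is unchanged while the sum over the part of `i` moves by `δ`. Both stay
  -- parallel to the former, which forces `δ` to be parallel to it unless it vanishes.
  have hzero : ∀ y' ∈ U, gram (y'.1 i) (y'.1 j) ≠ 0 → partSum κ y'.1 s = 0 := by
    intro y' hy' hg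
    by_contra hs
    obtain ⟨z, hz, δ, hδ, hzy⟩ := exists_bend y' (hUo.mem_nhds hy')
      (fun h => hκij (congrArg κ h)) hg hs
    have h1 := partSum_bend κ y'.1 i j δ s
    have h2 := partSum_bend κ y'.1 i j δ (κ i)
    rw [← hzy, if_neg hsi, if_neg hsj, add_zero, sub_zero] at h1
    rw [← hzy, if_pos rfl, if_neg (Ne.symm hκij), sub_zero] at h2
    obtain ⟨r, hr⟩ := exists_smul_of_gram_eq_zero hs (hbad y' hy' s (κ i))
    obtain ⟨r', hr'⟩ := exists_smul_of_gram_eq_zero (by rwa [h1]) (hbad z hz s (κ i))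
    apply hδ
    have : δ = (r' - r) • partSum κ y'.1 s := by
      rw [sub_smul, ← hr, ← h1, ← hr', h2]; abel
    rw [this]
    conv_lhs => rw [← one_smul ℝ (partSum κ y'.1 s)]
    rw [smul_smul]
    exact gram_smul_smul _ _ _
  obtain ⟨k, hk⟩ := hκ s
  obtain ⟨m, hkm, hm⟩ : ∃ m, κ m ≠ s ∧ gram (y.1 k) (y.1 m) ≠ 0 := by
    by_contra! h
    obtain ⟨r, hr⟩ := exists_smul_of_gram_eq_zero (hval y k) (h i hsi)
    obtain ⟨r', hr'⟩ := exists_smul_of_gram_eq_zero (hval y k) (h j hsj)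
    exact hij (by rw [hr, hr']; exact gram_smul_smul _ _ _)
  have hopen : IsOpen {y : closedPolygons ℓ | gram (y.1 i) (y.1 j) ≠ 0} :=
    isOpen_gram_ne_zero ((continuous_apply i).comp continuous_subtype_val)
      ((continuous_apply j).comp continuous_subtype_val)
  -- The bend is small enough to keep `i` and `j` nonparallel, so the sum over `s` is zero before
  -- and after, although it moves by `δ`. The vector `y.1 k` only serves to ensure `δ ≠ 0`.
  obtain ⟨z, ⟨hzU, hz⟩, δ, hδ, hzy⟩ := exists_bend y ((hUo.inter hopen).mem_nhds ⟨hyU, hij⟩)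
    (i := k) (j := m) (fun h => hkm (h ▸ hk)) hm (hval y k)
  have h1 := partSum_bend κ y.1 k m δ s
  rw [← hzy, hzero z hzU hz, hzero y hyU hij, if_pos hk, if_neg hkm, zero_add, sub_zero] at h1
  rw [← h1, gram_comm, gram_zero_left] at hδ
  exact hδ rfl

end Parts

namespace HalfEdgeGraph

variable {n : ℕ} {V : Type*} {Γ : HalfEdgeGraph n V}

/-! ### Regular points -/

/-- A vertex without internal edges would be the only vertex by connectedness, and would carry at
least four half-edges. This is where `4 ≤ n` matters. -/
theorem Admissible.exists_internal (hn : 4 ≤ n) (hΓ : Γ.Admissible) (v : V) :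
    ∃ a : Γ.EInt, Γ.Incident v (Sum.inl a) := by
  by_contra! h
  have hV : ∀ p, p = v := fun p => by
    by_contra hp
    obtain ⟨w, hw, -⟩ := exists_neighbor_far hΓ.connected hΓ.acyclic hp
    exact h ⟨s(v, w), hw⟩ (Sym2.mem_mk_left v w)
  have h3 := hΓ.trivalent v
  have hsub : Set.range (Sum.inr : Fin n → Γ.Edge) ⊆ {e | Γ.Incident v e} := by
    rintro - ⟨i, rfl⟩
    exact hV _
  have hle := Set.ncard_le_ncard hsub (Set.finite_of_ncard_ne_zero (by rw [h3]; norm_num))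
  rw [h3, Set.ncard_range_of_injective Sum.inr_injective, Nat.card_fin] at hle
  omega

/-- The triangle inequalities at the vertices are strict. -/
def Strict (D : Γ.Edge → ℝ) : Prop :=
  ∀ v : V, ∀ a b c : Γ.Edge, Γ.Incident v a → Γ.Incident v b → Γ.Incident v c →
    a ≠ b → b ≠ c → a ≠ c → |D a - D b| < D c ∧ D c < D a + D b

/-- Each triangle inequality at `v` involves all three edges there, one of them internal. Moving
that length slightly both ways preserves the weak inequalities, so they were strict. -/
theorem Admissible.strict_of_mem_interior (hn : 4 ≤ n) (hΓ : Γ.Admissible) {ℓ : Fin n → ℝ}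
    {d : Γ.EInt → ℝ} (hd : d ∈ interior (Γ.slicedPolyhedron ℓ)) :
    Strict (Γ := Γ) (Sum.elim d ℓ) := by
  classical
  have key : ∀ (v : V) (a : Γ.EInt) (b c : Γ.Edge), Γ.Incident v (Sum.inl a) → Γ.Incident v b →
      Γ.Incident v c → Sum.inl a ≠ b → b ≠ c → Sum.inl a ≠ c →
      Sum.elim d ℓ c < d a + Sum.elim d ℓ b ∧ d a < Sum.elim d ℓ b + Sum.elim d ℓ c ∧
        Sum.elim d ℓ b < d a + Sum.elim d ℓ c := by
    intro v a b c ha hb hc hab hbc hac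
    have hcont : Continuous fun t : ℝ => d + Pi.single a t :=
      continuous_const.add (continuous_pi fun b => by
        by_cases h : b = a
        · subst h; simpa using continuous_id'
        · simpa [h] using continuous_const)
    have h0 : ∀ᶠ t in 𝓝 (0 : ℝ), d + Pi.single a t ∈ Γ.slicedPolyhedron ℓ :=
      hcont.continuousAt.eventually (by simpa using mem_interior_iff_mem_nhds.1 hd)
    have h1 : ∀ᶠ t in 𝓝 (0 : ℝ), d + Pi.single a (-t) ∈ Γ.slicedPolyhedron ℓ :=
      (hcont.comp continuous_neg).continuousAt.eventually
        (by simpa using mem_interior_iff_mem_nhds.1 hd)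
    obtain ⟨t, ⟨h2, h3⟩, ht⟩ := (((h0.and h1).filter_mono nhdsWithin_le_nhds).and
      self_mem_nhdsWithin : ∀ᶠ t in 𝓝[>] (0 : ℝ), _).exists
    have ht0 : 0 < t := ht
    have hval : ∀ (t : ℝ) (e : Γ.Edge), Sum.inl a ≠ e →
        Sum.elim (d + Pi.single a t) ℓ e = Sum.elim d ℓ e := by
      rintro t (a' | i) he
      · have : a' ≠ a := fun h => he (h ▸ rfl)
        simp [this]
      · rfl
    have h4 := h2.2 v _ b c ha hb hc hab hbc hac
    have h5 := h3.2 v _ b c ha hb hc hab hbc hac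
    rw [hval _ b hab, hval _ c hac] at h4 h5
    simp only [Sum.elim_inl, Pi.add_apply, Pi.single_eq_same, abs_le] at h4 h5
    refine ⟨?_, ?_, ?_⟩ <;> linarith [h4.1.1, h4.1.2, h4.2, h5.1.1, h5.1.2, h5.2]
  intro v a b c ha hb hc hab hbc hac
  obtain ⟨a', ha'⟩ := hΓ.exists_internal hn v
  rw [abs_lt]
  rcases (hΓ.incident_iff ha hb hc hab hbc hac _).1 ha' with rfl | rfl | rfl
  · have := key v a' b c ha hb hc hab hbc hac
    simp only [Sum.elim_inl]
    refine ⟨⟨?_, ?_⟩, ?_⟩ <;> linarith [this.1, this.2.1, this.2.2]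
  · have := key v a' a c hb ha hc hab.symm hac hbc
    simp only [Sum.elim_inl]
    refine ⟨⟨?_, ?_⟩, ?_⟩ <;> linarith [this.1, this.2.1, this.2.2]
  · have := key v a' a b hc ha hb hac.symm hab hbc.symm
    simp only [Sum.elim_inl]
    refine ⟨⟨?_, ?_⟩, ?_⟩ <;> linarith [this.1, this.2.1, this.2.2]

/-- Finitely many strict inequalities persist nearby, and nonnegativity follows from them. -/
theorem Admissible.mem_interior_of_strict [Finite V] (hΓ : Γ.Admissible) {ℓ : Fin n → ℝ}
    {d : Γ.EInt → ℝ} (hd : Strict (Γ := Γ) (Sum.elim d ℓ)) :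
    d ∈ interior (Γ.slicedPolyhedron ℓ) := by
  have := hΓ.connected.nonempty
  rw [mem_interior_iff_mem_nhds]
  have hcont : ∀ e : Γ.Edge, Continuous fun d : Γ.EInt → ℝ => Sum.elim d ℓ e := by
    rintro (a | i)
    · exact continuous_apply a
    · exact continuous_const
  have hev : ∀ᶠ d' in 𝓝 d, Strict (Γ := Γ) (Sum.elim d' ℓ) := by
    unfold Strict
    simp only [Filter.eventually_all, Filter.eventually_and]
    intro v a b c ha hb hc hab hbc hac
    obtain ⟨h1, h2⟩ := hd v a b c ha hb hc hab hbc hac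
    exact ⟨((hcont a).sub (hcont b)).abs.continuousAt.eventually_lt (hcont c).continuousAt h1,
      (hcont c).continuousAt.eventually_lt ((hcont a).add (hcont b)).continuousAt h2⟩
  filter_upwards [hev] with d' hd'
  refine ⟨fun e => ?_, fun v a b c ha hb hc hab hbc hac => ?_⟩
  · obtain ⟨v, hv⟩ := exists_incident_vertex e
    obtain ⟨b, c, h1, h2, h3, h⟩ := hΓ.exists_triple v hv
    exact (abs_nonneg _).trans (hd' v b c e ((h b).2 (by simp)) ((h c).2 (by simp)) hv h3 h2.symm
      h1.symm).1.le
  · exact ⟨(hd' v a b c ha hb hc hab hbc hac).1.le, (hd' v a b c ha hb hc hab hbc hac).2.le⟩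

/-- The regular points are the classes of polygons all of whose triangles are nondegenerate. -/
theorem Admissible.gram_flag_ne_zero (hn : 4 ≤ n) (hΓ : Γ.Admissible) (o : Γ.Orientation)
    {ℓ : Fin n → ℝ} {x : closedPolygons ℓ} (hx : ModuliSpace.mk x ∈ o.regularSet ℓ) {v : V}
    {a b : Γ.Edge} (ha : Γ.Incident v a) (hb : Γ.Incident v b) (hab : a ≠ b) :
    gram (Γ.flag x.1 v a) (Γ.flag x.1 v b) ≠ 0 := by
  have hs := hΓ.strict_of_mem_interior hn hx
  obtain ⟨c, hac, hbc, h⟩ : ∃ c, a ≠ c ∧ b ≠ c ∧ ∀ f, Γ.Incident v f ↔ f = a ∨ f = b ∨ f = c := by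
    obtain ⟨b', c', h1, h2, h3, h⟩ := hΓ.exists_triple v ha
    rcases (h b).1 hb with rfl | rfl | rfl
    · exact (hab rfl).elim
    · exact ⟨c', h2, h3, h⟩
    · exact ⟨b', h1, h3.symm, fun f => by rw [h]; tauto⟩
  have hc := (h c).2 (by simp)
  rw [gram_ne_zero_iff (hΓ.balanced_flag x.2.2 v a b c hab hac hbc h), hΓ.norm_flag o x ha,
    hΓ.norm_flag o x hb, hΓ.norm_flag o x hc]
  exact hs v a b c ha hb hc hab hbc hac

theorem Admissible.mem_regularSet [Finite V] (hΓ : Γ.Admissible) (o : Γ.Orientation)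
    {ℓ : Fin n → ℝ} {x : closedPolygons ℓ}
    (hx : ∀ v, ∃ a b, Γ.Incident v a ∧ Γ.Incident v b ∧ a ≠ b ∧
      gram (Γ.flag x.1 v a) (Γ.flag x.1 v b) ≠ 0) :
    ModuliSpace.mk x ∈ o.regularSet ℓ := by
  refine hΓ.mem_interior_of_strict fun v a b c ha hb hc hab hbc hac => ?_
  have h := hΓ.incident_iff ha hb hc hab hbc hac
  have hbal := hΓ.balanced_flag x.2.2 v a b c hab hac hbc h
  rw [← hΓ.norm_flag o x ha, ← hΓ.norm_flag o x hb, ← hΓ.norm_flag o x hc,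
    ← gram_ne_zero_iff hbal]
  obtain ⟨a', b', ha', hb', hab', hg⟩ := hx v
  intro h0
  have h02 := (gram_of_sum_eq_zero hbal).trans h0
  have h12 := (gram_of_sum_eq_zero (a := Γ.flag x.1 v b) (b := Γ.flag x.1 v a)
    (c := Γ.flag x.1 v c) (by rw [← hbal]; abel)).trans ((gram_comm _ _).trans h0)
  apply hg
  rcases (h a').1 ha' with rfl | rfl | rfl <;> rcases (h b').1 hb' with rfl | rfl | rfl <;>
  first
    | exact absurd rfl hab'
    | assumption
    | (rw [gram_comm]; assumption)

/-! ### Density of the regular points -/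

theorem continuous_flag (v : V) (e : Γ.Edge) : Continuous fun x : Fin n → E3 => Γ.flag x v e := by
  refine continuous_finsetSum _ fun i _ => ?_
  split_ifs
  exacts [continuous_apply i, continuous_const]

theorem Admissible.continuous_lengths (hΓ : Γ.Admissible) (o : Γ.Orientation) (ℓ : Fin n → ℝ) :
    Continuous (o.lengths ℓ) := by
  refine (isQuotientMap_quotient_mk' (s := orbitSetoid ℓ)).continuous_iff.2 ?_
  refine continuous_pi fun a => ?_
  have : Continuous fun x : closedPolygons ℓ => ‖Γ.flag x.1 (o.dart a).snd (Sum.inl a)‖ :=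
    ((continuous_flag _ _).comp continuous_subtype_val).norm
  exact this.congr fun x => (hΓ.lengths_mk o x a).symm

theorem Admissible.isOpen_regularSet (hΓ : Γ.Admissible) (o : Γ.Orientation) (ℓ : Fin n → ℝ) :
    IsOpen (o.regularSet ℓ) :=
  isOpen_interior.preimage (hΓ.continuous_lengths o ℓ)

theorem Admissible.dense_gram_flag [Finite V] (hn : 4 ≤ n) (hΓ : Γ.Admissible) {ℓ : Fin n → ℝ}
    (hpos : ∀ i, 0 < ℓ i) (hpoly : ∀ j, ℓ j < 1 / 2 * ∑ i, ℓ i) (v : V) :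
    ∃ a b, Γ.Incident v a ∧ Γ.Incident v b ∧ a ≠ b ∧
      Dense {x : closedPolygons ℓ | gram (Γ.flag x.1 v a) (Γ.flag x.1 v b) ≠ 0} := by
  classical
  obtain ⟨a, ha⟩ := hΓ.exists_incident v
  obtain ⟨b, c, hab, hac, hbc, h⟩ := hΓ.exists_triple v ha
  have hb := (h b).2 (by simp)
  have hc := (h c).2 (by simp)
  have hdisj : ∀ {e f i}, Γ.Incident v e → Γ.Incident v f → i ∈ Γ.branch v e →
      i ∈ Γ.branch v f → e = f := fun he hf hie hif =>
    (hΓ.existsUnique_branch v _).unique ⟨he, hie⟩ ⟨hf, hif⟩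
  -- The half-edges are coloured by the branch at `v` containing them, so the part sums are the flag
  -- vectors.
  let κ : Fin n → Fin 3 := fun i =>
    if i ∈ Γ.branch v a then 0 else if i ∈ Γ.branch v b then 1 else 2
  have h0 : ∀ i, κ i = 0 ↔ i ∈ Γ.branch v a := fun i => by
    simp only [κ]; split_ifs <;> simp [*]
  have h1 : ∀ i, κ i = 1 ↔ i ∈ Γ.branch v b := fun i => by
    simp only [κ]
    split_ifs with h2 h3
    · simp only [zero_ne_one, false_iff]
      exact fun h3 => hab (hdisj ha hb h2 h3)
    · simpa using h3
    · simpa using h3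
  have hκ : Function.Surjective κ := by
    intro p
    fin_cases p
    · obtain ⟨i, hi⟩ := hΓ.branch_nonempty ha
      exact ⟨i, (h0 i).2 hi⟩
    · obtain ⟨i, hi⟩ := hΓ.branch_nonempty hb
      exact ⟨i, (h1 i).2 hi⟩
    · obtain ⟨i, hi⟩ := hΓ.branch_nonempty hc
      refine ⟨i, ?_⟩
      simp only [κ]
      rw [if_neg fun h' => hac (hdisj ha hc h' hi), if_neg fun h' => hbc (hdisj hb hc h' hi)]
      rfl
  refine ⟨a, b, ha, hb, hab, ?_⟩
  convert dense_gram_partSum (by omega) hpos hpoly hκ using 6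
  · exact Finset.sum_congr rfl fun i _ => if_congr (h0 i).symm rfl rfl
  · exact Finset.sum_congr rfl fun i _ => if_congr (h1 i).symm rfl rfl

theorem isClosed_closedPolygons (ℓ : Fin n → ℝ) : IsClosed (closedPolygons ℓ) := by
  have h1 : IsClosed {x : Fin n → E3 | ∀ i, ‖x i‖ = ℓ i} := by
    simp only [Set.ofPred_forall]
    exact isClosed_iInter fun i => isClosed_eq (continuous_apply i).norm continuous_const
  exact h1.inter (isClosed_eq (continuous_finsetSum _ fun i _ => continuous_apply i)
    continuous_const)

theorem Admissible.dense_regularSet [Finite V] (hn : 4 ≤ n) (hΓ : Γ.Admissible)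
    (o : Γ.Orientation) {ℓ : Fin n → ℝ}
    (hpos : ∀ i, 0 < ℓ i) (hpoly : ∀ j, ℓ j < 1 / 2 * ∑ i, ℓ i) :
    Dense (o.regularSet ℓ) := by
  choose a b ha hb hab hd using hΓ.dense_gram_flag hn hpos hpoly
  -- Completeness gives Baire's theorem for closed polygons; the continuous quotient map, being
  -- surjective, then carries the dense set to a dense set.
  have := (isClosed_closedPolygons ℓ).completeSpace_coe
  have hdense := dense_iInter_of_isOpen (fun v => isOpen_gram_ne_zero
    ((continuous_flag v (a v)).comp continuous_subtype_val)
    ((continuous_flag v (b v)).comp continuous_subtype_val)) hd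
  refine (mk_surjective.denseRange.dense_image continuous_mk hdense).mono ?_
  rintro - ⟨x, hx, rfl⟩
  exact hΓ.mem_regularSet o fun v => ⟨a v, b v, ha v, hb v, hab v, Set.mem_iInter.1 hx v⟩

theorem Admissible.flag_ne_zero (hn : 4 ≤ n) (hΓ : Γ.Admissible) (o : Γ.Orientation)
    {ℓ : Fin n → ℝ} {x : closedPolygons ℓ} (hx : ModuliSpace.mk x ∈ o.regularSet ℓ) {v : V}
    {a : Γ.Edge} (ha : Γ.Incident v a) : Γ.flag x.1 v a ≠ 0 := by
  obtain ⟨b, c, hab, -, -, h⟩ := hΓ.exists_triple v ha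
  exact ne_zero_of_gram (hΓ.gram_flag_ne_zero hn o hx ha ((h b).2 (by simp)) hab)

theorem Admissible.regularSet_subset (hn : 4 ≤ n) (hΓ : Γ.Admissible) (o : Γ.Orientation)
    (ℓ : Fin n → ℝ) : o.regularSet ℓ ⊆ o.nonvanishingSet ℓ := by
  classical
  intro p hp
  refine ⟨?_, fun a => ?_⟩
  · rintro ⟨x, ⟨u, hu⟩, rfl⟩
    choose c hc using hu
    obtain ⟨v⟩ := hΓ.connected.nonempty
    obtain ⟨a, ha⟩ := hΓ.exists_incident v
    obtain ⟨b, _, hab, -, -, h⟩ := hΓ.exists_triple v ha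
    have hflag : ∀ e, Γ.flag x.1 v e = (∑ i, if i ∈ Γ.branch v e then c i else 0) • u := fun e => by
      rw [Finset.sum_smul]
      refine Finset.sum_congr rfl fun i _ => ?_
      split_ifs
      · exact hc i
      · rw [zero_smul]
    refine hΓ.gram_flag_ne_zero hn o hp ha ((h b).2 (by simp)) hab ?_
    rw [hflag, hflag]
    exact gram_smul_smul _ _ _
  · obtain ⟨x, rfl⟩ := mk_surjective p
    rw [hΓ.lengths_mk, norm_ne_zero_iff]
    exact hΓ.flag_ne_zero hn o hp (o.incident_snd a)

/-! ### Differentials -/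

open Classical in
/-- The vector at a flag, as a linear function of the polygon. -/
def flagL (v : V) (e : Γ.Edge) : (Fin n → E3) →L[ℝ] E3 :=
  ∑ i, if i ∈ Γ.branch v e then ContinuousLinearMap.proj i else 0

theorem flagL_apply (v : V) (e : Γ.Edge) (x : Fin n → E3) : flagL v e x = Γ.flag x v e := by
  classical
  rw [flagL, flag, sum_apply]
  refine Finset.sum_congr rfl fun i _ => ?_
  split_ifs <;> rfl

theorem fderiv_norm_flag {v : V} {e : Γ.Edge} {x : Fin n → E3} (hx : Γ.flag x v e ≠ 0)
    (w : Fin n → E3) :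
    fderiv ℝ (fun y => ‖Γ.flag y v e‖) x w = ⟪Γ.flag x v e, Γ.flag w v e⟫ / ‖Γ.flag x v e‖ := by
  have h := ((flagL (Γ := Γ) v e).hasFDerivAt (x := x)).norm_sq.sqrt
    (by rw [flagL_apply]; simpa using hx)
  simp only [flagL_apply, Real.sqrt_sq (norm_nonneg _)] at h
  rw [h.fderiv]
  simp only [smul_apply, ContinuousLinearMap.comp_apply, innerSL_apply_apply,
    flagL_apply, smul_eq_mul, nsmul_eq_mul]
  have : ‖Γ.flag x v e‖ ≠ 0 := norm_ne_zero_iff.2 hx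
  field_simp
  norm_num

theorem contDiffAt_norm_flag {v : V} {e : Γ.Edge} {x : Fin n → E3} (hx : Γ.flag x v e ≠ 0) :
    ContDiffAt ℝ ∞ (fun y => ‖Γ.flag y v e‖) x := by
  have h := (flagL (Γ := Γ) v e).contDiff (n := ∞)
  simp only [funext (flagL_apply (Γ := Γ) v e)] at h
  exact h.contDiffAt.norm ℝ hx

theorem inner_bracket {ξ x v : E3}
    (h : toSu2 v = toSu2 ξ * toSu2 x - toSu2 x * toSu2 ξ) : ⟪x, v⟫ = 0 := by
  have hv := congrArg fromSu2 h
  rw [fromSu2_toSu2] at hv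
  rw [inner_E3, hv]
  simp [fromSu2, toSu2]
  ring

/-- A flag vector is a sum of sides, so it moves by its own bracket with `ξ`, which is orthogonal to
it. Hence the differentials of the lengths vanish along orbits and descend to the quotient. -/
theorem inner_flag_orbitTangent {x w : Fin n → E3} (hw : w ∈ orbitTangent x) (v : V)
    (e : Γ.Edge) : ⟪Γ.flag x v e, Γ.flag w v e⟫ = 0 := by
  obtain ⟨ξ, hξ⟩ := hw
  refine inner_bracket (ξ := ξ) ?_
  rw [flag, flag, map_sum, map_sum, Finset.mul_sum, Finset.sum_mul, ← Finset.sum_sub_distrib]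
  refine Finset.sum_congr rfl fun i _ => ?_
  split_ifs
  · exact hξ i
  · simp

/-- Nondegenerate triangles have variations with arbitrary derivatives of the lengths. -/
theorem Admissible.exists_variation [Finite V] (hΓ : Γ.Admissible) {x : Fin n → E3}
    (hx : ∑ i, x i = 0)
    (hg : ∀ v a b, Γ.Incident v a → Γ.Incident v b → a ≠ b →
      gram (Γ.flag x v a) (Γ.flag x v b) ≠ 0) (r : Γ.Edge → ℝ) :
    ∃ w : Fin n → E3, ∑ i, w i = 0 ∧
      ∀ v e, Γ.Incident v e → ⟪Γ.flag x v e, Γ.flag w v e⟫ = r e := by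
  have hloc : ∀ (v : V) (e : Γ.Edge) (u : E3), Γ.Incident v e → ⟪Γ.flag x v e, u⟫ = r e →
      ∃ z, (Balanced v z ∧ ∀ e, Γ.Incident v e → ⟪Γ.flag x v e, z e⟫ = r e) ∧ z e = u := by
    intro v e u he hu
    obtain ⟨b, c, h1, h2, h3, h⟩ := hΓ.exists_triple v he
    have hb := (h b).2 (by simp)
    -- The first value is what the condition at `c` demands: both the third flag and its variation
    -- are minus the sums of the other two, and the product is expanded.
    obtain ⟨y, hy1, hy2⟩ := exists_inner_eq (hg v e b he hb h1)
      (r c - r e - ⟪Γ.flag x v b, u⟫ - r b) (r b)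
    obtain ⟨z, hz, za, zb, zc⟩ := exists_balanced h1 h2 h3 h (add_neg_cancel (u + y))
    refine ⟨z, ⟨hz, fun f hf => ?_⟩, za⟩
    rcases (h f).1 hf with rfl | rfl | rfl
    · rw [za, hu]
    · rw [zb, hy2]
    · have hs := hΓ.balanced_flag hx v e b f h1 h2 h3 h
      rw [zc, show Γ.flag x v f = -(Γ.flag x v e + Γ.flag x v b) by
        rw [eq_neg_iff_add_eq_zero, ← hs]; abel, inner_neg_neg, inner_add_left, inner_add_right,
        inner_add_right, hu, hy1, hy2]
      ring
  obtain ⟨z, hz, hanti⟩ := hΓ.exists_glue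
    (fun v z => Balanced v z ∧ ∀ e, Γ.Incident v e → ⟪Γ.flag x v e, z e⟫ = r e) (fun v => by
      obtain ⟨e, he⟩ := hΓ.exists_incident v
      obtain ⟨b, _, h1, -, -, h⟩ := hΓ.exists_triple v he
      obtain ⟨u, hu, -⟩ := exists_inner_eq (hg v e b he ((h b).2 (by simp)) h1) (r e) 0
      obtain ⟨z, hz, -⟩ := hloc v e u he hu
      exact ⟨z, hz⟩) (fun v w h z hz => by
      refine hloc w _ _ (show Γ.Incident w (Sum.inl ⟨s(v, w), h⟩) from Sym2.mem_mk_right v w) ?_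
      rw [hΓ.antisymm_flag hx v w h, inner_neg_neg]
      exact hz.2 _ (show Γ.Incident v (Sum.inl ⟨s(v, w), h⟩) from Sym2.mem_mk_left v w))
  refine ⟨Γ.tips z, hΓ.sum_tips (fun v => (hz v).1) hanti, fun v e he => ?_⟩
  rw [hΓ.flag_tips (fun v => (hz v).1) hanti he]
  exact (hz v).2 e he

theorem Admissible.exists_differentials [Finite V] (hn : 4 ≤ n) (hΓ : Γ.Admissible)
    (o : Γ.Orientation) {ℓ : Fin n → ℝ} {x : closedPolygons ℓ}
    (hx : ModuliSpace.mk x ∈ o.regularSet ℓ) :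
    ∃ L : Γ.EInt → (QuotientTangent x.1 →ₗ[ℝ] ℝ),
      (∀ a, HasDifferentialAt (fun p => o.lengths ℓ p a) x (L a)) ∧ LinearIndependent ℝ L := by
  classical
  have hne : ∀ a, Γ.flag x.1 (o.dart a).snd (Sum.inl a) ≠ 0 := fun a =>
    hΓ.flag_ne_zero hn o hx (o.incident_snd a)
  have hL : ∀ a : Γ.EInt, ∃ L : QuotientTangent x.1 →ₗ[ℝ] ℝ, ∀ w : ↥(polygonTangent x.1),
      L (Submodule.Quotient.mk w) =
        fderiv ℝ (fun y => ‖Γ.flag y (o.dart a).snd (Sum.inl a)‖) x.1 w.1 := by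
    intro a
    refine ⟨Submodule.liftQ _ ((fderiv ℝ (fun y => ‖Γ.flag y (o.dart a).snd (Sum.inl a)‖)
      x.1).toLinearMap ∘ₗ (polygonTangent x.1).subtype) ?_, fun w => rfl⟩
    intro w hw
    have hw' : w.1 ∈ orbitTangent x.1 := hw
    change fderiv ℝ _ x.1 w.1 = 0
    rw [fderiv_norm_flag (hne a), inner_flag_orbitTangent hw', zero_div]
  choose L hL using hL
  refine ⟨L, fun a => ⟨_, contDiffAt_norm_flag (hne a),
    Filter.Eventually.of_forall fun y => (hΓ.lengths_mk o y a).symm, hL a⟩, ?_⟩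
  rw [linearIndependent_iff']
  intro s c hc b hb
  -- The prescribed derivatives vanish on the half-edges, so `w` is tangent to the closed polygons,
  -- and only `L b` is nonzero on it.
  obtain ⟨w, hw, hwr⟩ := hΓ.exists_variation x.2.2
    (fun v a b ha hb hab => hΓ.gram_flag_ne_zero hn o hx ha hb hab) (Pi.single (Sum.inl b) 1)
  have hwt : w ∈ polygonTangent x.1 := by
    refine ⟨fun i => ?_, hw⟩
    have := hwr (Γ.endpoint i) (Sum.inr i) rfl
    rw [flag_inr, flag_inr] at this
    simpa using this
  have hval : ∀ a, L a (Submodule.Quotient.mk ⟨w, hwt⟩) =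
      if a = b then ‖Γ.flag x.1 (o.dart b).snd (Sum.inl b)‖⁻¹ else 0 := by
    intro a
    rw [hL, fderiv_norm_flag (hne a), hwr _ _ (o.incident_snd a)]
    split_ifs with h
    · subst h; simp
    · simp [h]
  have := LinearMap.congr_fun hc (Submodule.Quotient.mk ⟨w, hwt⟩)
  simp only [LinearMap.sum_apply, LinearMap.smul_apply, hval, smul_eq_mul, mul_ite, mul_zero,
    Finset.sum_ite_eq', hb, if_true, LinearMap.zero_apply] at this
  exact (mul_eq_zero.1 this).resolve_right (inv_ne_zero (norm_ne_zero_iff.2 (hne b)))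

end HalfEdgeGraph

end PolygonSpace

end

theorem mainTheorem9 {n : ℕ} (hn : 4 ≤ n) {V : Type*} [Finite V]
    (Γ : PolygonSpace.HalfEdgeGraph n V) (hΓ : Γ.Admissible) (o : Γ.Orientation)
    (ℓ : Fin n → ℝ) (hpos : ∀ i, 0 < ℓ i) (hpoly : ∀ j, ℓ j < 1 / 2 * ∑ i, ℓ i) :
    Set.range (o.lengths ℓ) = Γ.slicedPolyhedron ℓ ∧
    (∀ d ∈ Γ.slicedPolyhedron ℓ, IsConnected (o.lengths ℓ ⁻¹' {d})) ∧
    IsOpen (o.regularSet ℓ) ∧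
    Dense (o.regularSet ℓ) ∧
    o.regularSet ℓ ⊆ o.nonvanishingSet ℓ ∧
    ∀ x : PolygonSpace.closedPolygons ℓ, PolygonSpace.ModuliSpace.mk x ∈ o.regularSet ℓ →
      ∃ L : Γ.EInt → (PolygonSpace.QuotientTangent x.1 →ₗ[ℝ] ℝ),
        (∀ a, PolygonSpace.HasDifferentialAt (fun p => o.lengths ℓ p a) x (L a)) ∧
        LinearIndependent ℝ L := by
  exact ⟨hΓ.range_lengths o ℓ, fun d hd => hΓ.isConnected_fibre o hd, hΓ.isOpen_regularSet o ℓ,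
    hΓ.dense_regularSet hn o hpos hpoly, hΓ.regularSet_subset hn o ℓ,
    fun x hx => hΓ.exists_differentials hn o hx⟩
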